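/- Let $G$ be a finite group, $N\lhd G$ a normal subgroup. Write $H^n(-)$ for group cohomology with coefficients in $\mathbb{C}^\times$ (trivial action), and $p_n^*:H^n(G/N)\to H^n(G)$ for the map induced by the projection $G\to G/N$; write $\operatorname{pr}^*$ for pullback of cochains along the projection. A $(2+1)$-dimensional gapless SPT (gSPT) with symmetry $G$ and gapped symmetry $N$ is represented by a cochain $\alpha\in C^3(G,\mathbb{C}^\times)$ such that $d\alpha=\operatorname{pr}^*\pi$ for some $\pi\in C^4(G/N,\mathbb{C}^\times)$, modulo coboundaries $dC^2(G,\mathbb{C}^\times)$ and cochains pulled back from $C^3(G/N,\mathbb{C}^\times)$. Its emergent anomaly is the class $[\pi]\in H^4(G/N)$, and the gSPT is intrinsically gapless (an igSPT) if this class is nonzero. A 3-cocycle on $G$ defines a gSPT (a weak one). Stacking is addition of cochains. For abelian groups $W,E$, say that $(G,N)$ has classification $W\times E$ if there are group isomorphisms $H^3(G)/\operatorname{im}p_3^*\cong W$ and $\ker p_4^*\cong E$ and a bijection from the set of gSPTs with symmetry $G$ and gapped symmetry $N$ to $W\times E$ under which the second component is the emergent anomaly, and under which stacking with the weak gSPT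 of a 3-cocycle on $G$ translates the first component by the class of that cocycle in $H^3(G)/\operatorname{im}p_3^*$. Then every pair $(G,N)$ has classification $\bigl(H^3(G)/\operatorname{im}p_3^*\bigr)\times\ker p_4^*$, and an igSPT with symmetry $G$ and gapped symmetry $N$ exists if and only if $\ker p_4^*\neq 0$. Moreover, writing $(a,b,\dots)$ for greatest common divisors and $p,q,n_1$ for arbitrary positive integers: 1. $G=\mathbb{Z}_4$, $N=\langle 2\rangle\cong\mathbb{Z}_2$ has classification $\mathbb{Z}_4\times 0$; there is no igSPT. 2. $G=\mathbb{Z}_{pq}$, $N=\langle q\rangle\cong\mathbb{Z}_p$ has classification $\mathbb{Z}_{p(p,q)}\times 0$; there is no igSPT. 3. $G=\mathbb{Z}_2\times\mathbb{Z}_4$, $N=\langle(0,2)\rangle\cong\mathbb{Z}_2$ has classification $(\mathbb{Z}_2\times\mathbb{Z}_4)\times\mathbb{Z}_2$; there is an igSPT. 4. $G=\mathbb{Z}_{n_1}\times\mathbb{Z}_{pq}$, $N=\langle(0,q)\rangle\cong\mathbb{Z}_p$ has classification $(\mathbb{Z}_{p(p,q)}\times\mathbb{Z}_{(p,n_1)})\times\mathbb{Z}_{(p,q,n_1)}$;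 there is an igSPT if and only if $(p,q,n_1)\neq 1$. 5. $G=S_3$, $N=A_3\cong\mathbb{Z}_3$ has classification $\mathbb{Z}_3\times 0$; there is no igSPT. 6. $G=D_4$ (the dihedral group of order $8$), $N=Z(D_4)\cong\mathbb{Z}_2$ has classification $\mathbb{Z}_4\times\mathbb{Z}_2^2$; there is an igSPT. -/

import Mathlib

noncomputable section

namespace GaplessSPT

open CategoryTheory groupCohomology

/-- The trivial `G`-module `ℂˣ`, written additively. -/
abbrev unitsRep (G : Type) [Group G] : Rep ℤ G := Rep.trivial ℤ G (Additive ℂˣ)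

/-- `Cⁿ(G, ℂˣ)`, the inhomogeneous cochains (functions `Gⁿ → ℂˣ`). -/
abbrev Cochain (n : ℕ) (G : Type) [Group G] : Type := (inhomogeneousCochains (unitsRep G)).X n

/-- The coboundary `d : Cⁿ(G, ℂˣ) → Cⁿ⁺¹(G, ℂˣ)`. -/
def cobd (n : ℕ) (G : Type) [Group G] : Cochain n G →+ Cochain (n + 1) G :=
  ((inhomogeneousCochains (unitsRep G)).d n (n + 1)).hom.toAddMonoidHom

/-- `Hⁿ(G, ℂˣ)`, group cohomology with trivial action on the coefficients. -/
abbrev Cohomology (n : ℕ) (G : Type) [Group G] : Type := groupCohomology (unitsRep G) n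

section Quotient

variable (G : Type) [Group G] (N : Subgroup G) [N.Normal]

/-- The pullback of coefficients along `p : G → G ⧸ N` is the identity of `ℂˣ`. -/
def coeffId : Rep.res (QuotientGroup.mk' N) (unitsRep (G ⧸ N)) ⟶ unitsRep G :=
  𝟙 (unitsRep G)

/-- Pullback of cochains `p^* : Cⁿ(G ⧸ N, ℂˣ) → Cⁿ(G, ℂˣ)` along `p : G → G ⧸ N`. -/
def inflCochain (n : ℕ) : Cochain n (G ⧸ N) →+ Cochain n G :=
  ((cochainsMap (QuotientGroup.mk' N) (coeffId G N)).f n).hom.toAddMonoidHom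

/-- `p_n^* : Hⁿ(G ⧸ N, ℂˣ) → Hⁿ(G, ℂˣ)`, induced by the projection `p : G → G ⧸ N`. -/
def infl (n : ℕ) : Cohomology n (G ⧸ N) →+ Cohomology n G :=
  (groupCohomology.map (QuotientGroup.mk' N) (coeffId G N) n).hom.toAddMonoidHom

/-- `H³(G, ℂˣ) / im p_3^*`. -/
abbrev WeakFactor : Type := Cohomology 3 G ⧸ (infl G N 3).range

/-- `ker p_4^*`. -/
abbrev AnomalyFactor : Type := (infl G N 4).ker

theorem inflCochain_injective (n : ℕ) : Function.Injective (inflCochain G N n) := by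
  intro x y h
  refine funext fun g => ?_
  obtain ⟨g', rfl⟩ : ∃ g' : Fin n → G, (fun i => (g' i : G ⧸ N)) = g :=
    ⟨fun i => (g i).out, funext fun i => Quotient.out_eq' (g i)⟩
  exact congrFun h g'

theorem cobd_inflCochain (n : ℕ) (x : Cochain n (G ⧸ N)) :
    cobd n G (inflCochain G N n x) = inflCochain G N (n + 1) (cobd n (G ⧸ N) x) :=
  congrArg (fun f => f.hom x) ((cochainsMap (QuotientGroup.mk' N) (coeffId G N)).comm n (n + 1))

theorem cobd_cobd (n : ℕ) (x : Cochain n G) : cobd (n + 1) G (cobd n G x) = 0 :=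
  congrArg (fun f => f.hom x) ((inhomogeneousCochains (unitsRep G)).d_comp_d n (n + 1) (n + 1 + 1))

/-- An inhomogeneous `n`-cocycle as an element of `Zⁿ(G, ℂˣ)`. -/
def toCycle (n : ℕ) (z : (cobd n G).ker) : (inhomogeneousCochains (unitsRep G)).cycles n :=
  (inhomogeneousCochains (unitsRep G)).cyclesMk z.1 (n + 1) (by simp) z.2

theorem iCycles_toCycle (n : ℕ) (z : (cobd n G).ker) :
    ((inhomogeneousCochains (unitsRep G)).iCycles n).hom (toCycle G n z) = z.1 :=
  (inhomogeneousCochains (unitsRep G)).i_cyclesMk (i := n) z.1 (n + 1) (by simp) z.2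

theorem iCycles_injective (n : ℕ) :
    Function.Injective ((inhomogeneousCochains (unitsRep G)).iCycles n).hom :=
  (ModuleCat.mono_iff_injective ((inhomogeneousCochains (unitsRep G)).iCycles n)).1 inferInstance

/-- The class in `Hⁿ(G, ℂˣ)` of an inhomogeneous `n`-cocycle. -/
def cocycleClass (n : ℕ) : (cobd n G).ker →+ Cohomology n G :=
  (groupCohomology.π (unitsRep G) n).hom.toAddMonoidHom.comp <|
    AddMonoidHom.mk' (toCycle G n) fun x y => by
      apply iCycles_injective G n
      rw [map_add, iCycles_toCycle, iCycles_toCycle, iCycles_toCycle]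
      rfl

theorem cocycleClass_cobd (n : ℕ) (x : Cochain n G) :
    cocycleClass G (n + 1) ⟨cobd n G x, cobd_cobd G n x⟩ = 0 := by
  have h : toCycle G (n + 1) ⟨cobd n G x, cobd_cobd G n x⟩ =
      ((inhomogeneousCochains (unitsRep G)).toCycles n (n + 1)).hom x := by
    apply iCycles_injective G (n + 1)
    rw [iCycles_toCycle]
    exact (congrArg (fun f => f.hom x)
      ((inhomogeneousCochains (unitsRep G)).toCycles_i n (n + 1))).symm
  refine (congrArg (groupCohomology.π (unitsRep G) (n + 1)).hom h).trans ?_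
  exact congrArg (fun f => f.hom x)
    ((inhomogeneousCochains (unitsRep G)).toCycles_comp_homologyπ n (n + 1))

/-- Domain wall decorations for the symmetry `G` with gapped symmetry `N`: `3`-cochains `α` on `G`
whose coboundary is pulled back from a `4`-cochain `π` on `G ⧸ N`. Up to normalization `α` restricts
to a `3`-cocycle `ω` on `N`; the further layers of `α` in the Lyndon–Hochschild–Serre filtration are
solutions `γ`, `p` of `d₂ω = 0`, `d₃ω = 0` and a cochain pulled back from `G ⧸ N`. The last
condition `d₄ω = 0` (which would make `α` a cocycle) is not imposed. -/
def decorations : AddSubgroup (Cochain 3 G) :=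
  (inflCochain G N 4).range.comap (cobd 3 G)

/-- Trivial decorations: coboundaries, and cochains pulled back from `G ⧸ N`. -/
def trivialDecorations : AddSubgroup (Cochain 3 G) :=
  (cobd 2 G).range ⊔ (inflCochain G N 3).range

/-- The group of `2+1`-dimensional gapless SPTs with symmetry `G` and gapped symmetry `N`:
decorations `(ω, γ, p)` up to equivalence, represented by `α` modulo coboundaries and modulo its
last layer, pulled back from `G ⧸ N`. -/
abbrev GSPT : Type := decorations G N ⧸ (trivialDecorations G N).addSubgroupOf (decorations G N)

/-- The unique `4`-cochain `π` on `G ⧸ N` with `d α = p^* π`. -/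
def anomalyCochain (α : decorations G N) : Cochain 4 (G ⧸ N) := α.2.choose

theorem inflCochain_anomalyCochain (α : decorations G N) :
    inflCochain G N 4 (anomalyCochain G N α) = cobd 3 G α.1 := α.2.choose_spec

theorem anomalyCochain_mem (α : decorations G N) :
    anomalyCochain G N α ∈ (cobd 4 (G ⧸ N)).ker := by
  apply inflCochain_injective G N 5
  rw [← cobd_inflCochain, inflCochain_anomalyCochain, cobd_cobd, map_zero]

/-- The class in `H⁴(G ⧸ N, ℂˣ)` of the cocycle `π` with `d α = p^* π`. -/
def decorationAnomaly : decorations G N →+ Cohomology 4 (G ⧸ N) :=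
  (cocycleClass (G ⧸ N) 4).comp <|
    AddMonoidHom.mk' (fun α => ⟨anomalyCochain G N α, anomalyCochain_mem G N α⟩) fun α β => by
      apply Subtype.ext
      apply inflCochain_injective G N 4
      change _ = inflCochain G N 4 (anomalyCochain G N α + anomalyCochain G N β)
      rw [map_add, inflCochain_anomalyCochain, inflCochain_anomalyCochain,
        inflCochain_anomalyCochain]
      exact map_add (cobd 3 G) α.1 β.1

theorem decorationAnomaly_trivial :
    (trivialDecorations G N).addSubgroupOf (decorations G N) ≤ (decorationAnomaly G N).ker := by
  rintro ⟨α, hα⟩ h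
  obtain ⟨_, ⟨x, rfl⟩, _, ⟨y, rfl⟩, h⟩ := AddSubgroup.mem_sup.1 (AddSubgroup.mem_addSubgroupOf.1 h)
  have key : anomalyCochain G N ⟨α, hα⟩ = cobd 3 (G ⧸ N) y := by
    apply inflCochain_injective G N 4
    rw [inflCochain_anomalyCochain, ← cobd_inflCochain]
    change cobd 3 G α = _
    have h' : _ = α := h
    rw [← h', map_add, cobd_cobd, zero_add]
  exact (congrArg (cocycleClass (G ⧸ N) 4) (Subtype.ext key)).trans (cocycleClass_cobd (G ⧸ N) 3 y)

/-- The emergent anomaly of a gapless SPT, a class in `H⁴(G ⧸ N, ℂˣ)`: for the gapless SPT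
represented by `α` it is the class of `π`, where `d α = p^* π`. -/
def emergentAnomaly : GSPT G N →+ Cohomology 4 (G ⧸ N) :=
  QuotientAddGroup.lift _ (decorationAnomaly G N) (decorationAnomaly_trivial G N)

/-- There is an intrinsically gapless SPT: a gapless SPT with nontrivial emergent anomaly. -/
def HasIGSPT : Prop := ∃ x : GSPT G N, emergentAnomaly G N x ≠ 0

theorem ker_cobd_le_decorations : (cobd 3 G).ker ≤ decorations G N := by
  intro z hz
  exact ⟨0, (map_zero _).trans (AddMonoidHom.mem_ker.1 hz).symm⟩

/-- The gapless SPT obtained from the gapped SPT of a `3`-cocycle on `G`. -/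
def weakGSPT : (cobd 3 G).ker →+ GSPT G N :=
  (QuotientAddGroup.mk' _).comp (AddSubgroup.inclusion (ker_cobd_le_decorations G N))

/-- The class in `H³(G, ℂˣ) / im p_3^*` of a `3`-cocycle on `G`. -/
def weakClass : (cobd 3 G).ker →+ WeakFactor G N :=
  (QuotientAddGroup.mk' _).comp (cocycleClass G 3)

/-- The gapless SPTs with symmetry `G` and gapped symmetry `N` have classification `W × E`:
`H³(G, ℂˣ) / im p_3^* ≃ W` and `ker p_4^* ≃ E` as abelian groups, and gapless SPTs are in bijection
with `W × E` in such a way that the second component is the emergent anomaly and stacking with a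
gapped `G`-SPT translates the first component by its class in `H³(G, ℂˣ) / im p_3^*`. -/
def HasClassification (W E : Type) [AddCommGroup W] [AddCommGroup E] : Prop :=
  ∃ (w : WeakFactor G N ≃+ W) (e : AnomalyFactor G N ≃+ E) (Φ : GSPT G N ≃ W × E),
    (∀ x, emergentAnomaly G N x = e.symm (Φ x).2) ∧
    ∀ x z, Φ (x + weakGSPT G N z) = ((Φ x).1 + w (weakClass G N z), (Φ x).2)

end Quotient

end GaplessSPT

end

/-! The general statement is an exact sequence `0 → H³(G)/im p₃* → GSPT → ker p₄* → 0`. A cocycle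
`z` is trivial as a gSPT iff `z = dx + pr*y`, and then `dy = 0` because pullback of cochains is
injective; a gSPT whose anomaly is `dβ` becomes a cocycle after subtracting `pr*β`; and `[π]` is an
emergent anomaly iff `pr*π` is a coboundary. A set-theoretic section of the anomaly then gives the
bijection, so that only the two outer groups have to be computed (`hasClassification_of_equiv`,
`hasIGSPT_iff`).

In every example `G` is a split extension of `ℤ/m` by a cyclic group `⟨x⟩` of order `p * q`, with `N
= ⟨x ^ q⟩`. For such groups the bar resolution is replaced by the total complex of a double complex
with one free generator in each bidegree `(i, j)`: horizontally the periodic resolution of `⟨x⟩`,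
vertically that of `ℤ/m`, twisted by a lift of conjugation by `y` (`Twist.resolution`). The
comparison `toBar` with the bar resolution is built from the contraction of the latter, so it is
strictly natural. Since the norm of `⟨x⟩` maps to `p` times the norm of its image in `G ⧸ N`,
inflation becomes multiplication by `p ^ (i / 2)` in bidegree `(i, j)` (`quotient_hom`,
`compare_inflCochain`).

What remains is linear algebra over the divisible group `ℂˣ`. Divisibility kills most coordinates;
the others are detected by explicit linear forms with values in torsion subgroups, which are cyclic
groups of roots of unity (`exists_weak_comm`, `exists_anomaly_comm` and their dihedral versions). -/

noncomputable section

namespace GaplessSPT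

open MonoidAlgebra (single of)

/-! ### Comparison theorem for complexes of projectives -/

section HomologicalAlgebra

/-- Dependent choice for sequences in a family of types. -/
theorem exists_seq {α : ℕ → Type*} (P : ∀ n, α n → Prop) (r : ∀ n, α n → α (n + 1) → Prop)
    (a₀ : α 0) (h₀ : P 0 a₀) (step : ∀ n a, P n a → ∃ b, P (n + 1) b ∧ r n a b) :
    ∃ a : ∀ n, α n, a 0 = a₀ ∧ ∀ n, r n (a n) (a (n + 1)) := by
  choose f hf hr using step
  let s : ∀ n, {a : α n // P n a} := fun n =>
    Nat.rec ⟨a₀, h₀⟩ (fun n a => ⟨f n a.1 a.2, hf n a.1 a.2⟩) n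
  exact ⟨fun n => (s n).1, rfl, fun n => hr n _ _⟩

variable {R : Type*} [Ring R]

/-- Projectivity is applied to `d` as a map onto its range, so `d` itself need not be surjective. -/
theorem exists_linearMap_lift {M Y Z : Type*} [AddCommGroup M] [AddCommGroup Y] [AddCommGroup Z]
    [Module R M] [Module R Y] [Module R Z] [Module.Projective R M] (a : M →ₗ[R] Y)
    (d : Z →ₗ[R] Y) (h : ∀ x, ∃ z, d z = a x) : ∃ b : M →ₗ[R] Z, ∀ x, d (b x) = a x := by
  obtain ⟨b, hb⟩ := Module.projective_lifting_property d.rangeRestrict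
    (a.codRestrict (LinearMap.range d) fun x => LinearMap.mem_range.2 (h x))
    d.surjective_rangeRestrict
  exact ⟨b, fun x => congrArg Subtype.val (LinearMap.congr_fun hb x)⟩

variable {X Y : ℕ → Type*} [∀ n, AddCommGroup (X n)] [∀ n, Module R (X n)]
  [∀ n, AddCommGroup (Y n)] [∀ n, Module R (Y n)] [∀ n, Module.Projective R (X n)]
  (dX : ∀ n, X (n + 1) →ₗ[R] X n) (dY : ∀ n, Y (n + 1) →ₗ[R] Y n)

/-- A map in degree zero from a complex of projectives to an exact complex extends to a
chain map. -/
theorem exists_chainMap (hX : ∀ n x, dX n (dX (n + 1) x) = 0)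
    (hY : ∀ n y, dY n y = 0 → ∃ z, dY (n + 1) z = y) (f₀ : X 0 →ₗ[R] Y 0)
    (h₀ : ∀ x, ∃ z, dY 0 z = f₀ (dX 0 x)) :
    ∃ f : ∀ n, X n →ₗ[R] Y n, f 0 = f₀ ∧ ∀ n x, dY n (f (n + 1) x) = f n (dX n x) := by
  refine exists_seq (α := fun n => X n →ₗ[R] Y n)
    (fun n f => ∀ x, ∃ z, dY n z = f (dX n x))
    (fun n f f' => ∀ x, dY n (f' x) = f (dX n x)) f₀ h₀ ?_
  intro n f hf
  obtain ⟨b, hb⟩ := exists_linearMap_lift (f ∘ₗ dX n) (dY n) hf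
  exact ⟨b, fun x => hY _ _ (by rw [hb, LinearMap.comp_apply, hX, map_zero]), hb⟩

/-- A chain map from a complex of projectives to an exact complex that is null-homotopic in degree
zero is null-homotopic. -/
theorem exists_homotopy (hX : ∀ n x, dX n (dX (n + 1) x) = 0)
    (hY : ∀ n y, dY n y = 0 → ∃ z, dY (n + 1) z = y) (f : ∀ n, X n →ₗ[R] Y n)
    (hf : ∀ n x, dY n (f (n + 1) x) = f n (dX n x)) (h₀ : ∀ x, ∃ z, dY 0 z = f 0 x) :
    ∃ h : ∀ n, X n →ₗ[R] Y (n + 1),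
      ∀ n x, dY (n + 1) (h (n + 1) x) + h n (dX n x) = f (n + 1) x := by
  obtain ⟨k₀, hk₀⟩ := exists_linearMap_lift (f 0) (dY 0) h₀
  obtain ⟨h, -, hh⟩ := exists_seq (α := fun n => X n →ₗ[R] Y (n + 1))
    -- This invariant is exactly what makes `f (n + 1) - h ∘ dX n` take values in cycles, so that
    -- exactness allows the next lift.
    (fun n h => ∀ x, dY n (h (dX n x)) = f n (dX n x))
    (fun n h h' => ∀ x, dY (n + 1) (h' x) = (f (n + 1) - h ∘ₗ dX n) x) k₀ (fun x => hk₀ _) (by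
      intro n h hh
      obtain ⟨b, hb⟩ := exists_linearMap_lift (f (n + 1) - h ∘ₗ dX n) (dY (n + 1)) (fun x =>
        hY _ _ (by simp [hf, hh]))
      exact ⟨b, fun x => by rw [hb]; simp [hX], hb⟩)
  exact ⟨h, fun n x => by rw [hh]; simp⟩

end HomologicalAlgebra

/-! ### The exact sequence of gapless SPTs -/

section Classification

variable (G : Type) [Group G]

theorem cocycleClass_surjective (n : ℕ) : Function.Surjective (cocycleClass G n) := by
  intro x
  refine groupCohomology_induction_on x fun y => ?_
  let c : Cochain n G := ((groupCohomology.inhomogeneousCochains (unitsRep G)).iCycles n).hom y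
  have hc : cobd n G c = 0 := congrArg (fun f => f.hom y)
    ((groupCohomology.inhomogeneousCochains (unitsRep G)).iCycles_d n (n + 1))
  refine ⟨⟨c, hc⟩, congrArg (groupCohomology.π (unitsRep G) n).hom ?_⟩
  exact iCycles_injective G n (iCycles_toCycle G n ⟨c, hc⟩)

theorem cocycleClass_eq_zero_iff (n : ℕ) (z : (cobd (n + 1) G).ker) :
    cocycleClass G (n + 1) z = 0 ↔ ∃ x, cobd n G x = z.1 := by
  constructor
  · intro h
    let C := groupCohomology.inhomogeneousCochains (unitsRep G)
    have e := CategoryTheory.ShortComplex.exact_of_g_is_cokernel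
      (CategoryTheory.ShortComplex.mk _ _ (C.toCycles_comp_homologyπ n (n + 1)))
      (C.homologyIsCokernel n (n + 1) (by simp))
    obtain ⟨x, hx⟩ := (CategoryTheory.ShortComplex.moduleCat_exact_iff _).1 e _ h
    refine ⟨x, ?_⟩
    rw [← iCycles_toCycle G (n + 1) z]
    refine Eq.trans ?_ (congrArg (C.iCycles (n + 1)).hom hx)
    exact (congrArg (fun f => f.hom x) (C.toCycles_i n (n + 1))).symm
  · rintro ⟨x, hx⟩
    rw [← cocycleClass_cobd G n x]
    congr 1
    exact Subtype.ext hx.symm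

theorem cobd_apply (n : ℕ) (c : Cochain n G) (v : Fin (n + 1) → G) :
    cobd n G c v = (c (Fin.tail v) : Additive ℂˣ) +
      ∑ j : Fin (n + 1), (-1 : ℤ) ^ ((j : ℕ) + 1) •
        (c (Fin.contractNth j (· * ·) v) : Additive ℂˣ) := by
  have h := groupCohomology.inhomogeneousCochains.d_def (A := unitsRep G) n
  exact congrFun (congrArg (fun f => f.hom c) h) v

variable (N : Subgroup G) [N.Normal]

theorem infl_cocycleClass (n : ℕ) (z : (cobd n (G ⧸ N)).ker) (z' : (cobd n G).ker)
    (h : z'.1 = inflCochain G N n z.1) :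
    infl G N n (cocycleClass (G ⧸ N) n z) = cocycleClass G n z' := by
  have e := groupCohomology.π_map (QuotientGroup.mk' N) (coeffId G N) n
  refine (congrArg (fun f => f.hom (toCycle (G ⧸ N) n z)) e).trans ?_
  refine congrArg (groupCohomology.π (unitsRep G) n).hom ?_
  apply iCycles_injective G n
  refine Eq.trans ?_ ((iCycles_toCycle G n z').trans h).symm
  rw [← iCycles_toCycle (G ⧸ N) n z]
  exact congrArg (fun f => f.hom (toCycle (G ⧸ N) n z))
    (HomologicalComplex.cyclesMap_i
      (groupCohomology.cochainsMap (QuotientGroup.mk' N) (coeffId G N)) n)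

theorem weakClass_surjective : Function.Surjective (weakClass G N) :=
  (QuotientAddGroup.mk'_surjective _).comp (cocycleClass_surjective G 3)

theorem weakClass_eq_zero_iff (z : (cobd 3 G).ker) :
    weakClass G N z = 0 ↔
      ∃ (y : (cobd 3 (G ⧸ N)).ker) (x : Cochain 2 G), z.1 = inflCochain G N 3 y.1 + cobd 2 G x := by
  have hy : ∀ y : (cobd 3 (G ⧸ N)).ker, inflCochain G N 3 y.1 ∈ (cobd 3 G).ker := fun y => by
    rw [AddMonoidHom.mem_ker, cobd_inflCochain, y.2, map_zero]
  refine (QuotientAddGroup.eq_zero_iff _).trans ?_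
  constructor
  · rintro ⟨c, hc⟩
    obtain ⟨y, rfl⟩ := cocycleClass_surjective _ _ c
    rw [infl_cocycleClass G N 3 y ⟨_, hy y⟩ rfl] at hc
    have h0 : cocycleClass G 3 (z - ⟨_, hy y⟩) = 0 := by rw [map_sub, hc, sub_self]
    obtain ⟨x, hx⟩ := (cocycleClass_eq_zero_iff G 2 _).1 h0
    exact ⟨y, x, by rw [hx]; exact (add_sub_cancel (inflCochain G N 3 y.1) z.1).symm⟩
  · rintro ⟨y, x, h⟩
    refine ⟨cocycleClass _ 3 y, ?_⟩
    rw [infl_cocycleClass G N 3 y ⟨_, hy y⟩ rfl]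
    have e : z = ⟨_, hy y⟩ + ⟨cobd 2 G x, cobd_cobd G 2 x⟩ := Subtype.ext h
    rw [e, map_add, cocycleClass_cobd, add_zero]

/-- The only difference between the two sides is that the pulled back cochain need not be closed for
a trivial gSPT. It is closed automatically: if `z = dx + pr*y` is a cocycle then `pr*(dy) = 0`, and
`pr*` is injective. -/
theorem weakGSPT_eq_zero_iff (z : (cobd 3 G).ker) :
    weakGSPT G N z = 0 ↔ weakClass G N z = 0 := by
  rw [weakClass_eq_zero_iff]
  refine (QuotientAddGroup.eq_zero_iff _).trans ?_
  rw [AddSubgroup.mem_addSubgroupOf]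
  constructor
  · intro h
    obtain ⟨_, ⟨x, rfl⟩, _, ⟨y, rfl⟩, h⟩ := AddSubgroup.mem_sup.1 h
    have h : cobd 2 G x + inflCochain G N 3 y = z.1 := h
    refine ⟨⟨y, ?_⟩, x, by rw [← h, add_comm]⟩
    apply inflCochain_injective G N 4
    have hz : cobd 3 G z.1 = 0 := z.2
    rw [← h, map_add, cobd_cobd, zero_add] at hz
    rw [← cobd_inflCochain, hz, map_zero]
  · rintro ⟨y, x, h⟩
    exact AddSubgroup.mem_sup.2 ⟨_, ⟨x, rfl⟩, _, ⟨y.1, rfl⟩, by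
      rw [add_comm]; exact h.symm⟩

theorem emergentAnomaly_mk (α : decorations G N) :
    emergentAnomaly G N (QuotientAddGroup.mk α) =
      cocycleClass (G ⧸ N) 4 ⟨anomalyCochain G N α, anomalyCochain_mem G N α⟩ := rfl

/-- A cochain `α` with `dα = pr*π` is at once a gSPT with anomaly `[π]` and a witness that `[π]`
inflates to zero. -/
theorem emergentAnomaly_range : (emergentAnomaly G N).range = (infl G N 4).ker := by
  ext c
  constructor
  · rintro ⟨x, rfl⟩
    induction x using QuotientAddGroup.induction_on with | H α => ?_
    rw [AddMonoidHom.mem_ker, emergentAnomaly_mk, infl_cocycleClass G N 4 _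
      ⟨cobd 3 G α.1, cobd_cobd G 3 _⟩ (inflCochain_anomalyCochain G N α).symm, cocycleClass_cobd]
  · intro hc
    obtain ⟨y, rfl⟩ := cocycleClass_surjective _ _ c
    have hy : inflCochain G N 4 y.1 ∈ (cobd 4 G).ker := by
      rw [AddMonoidHom.mem_ker, cobd_inflCochain, y.2, map_zero]
    rw [AddMonoidHom.mem_ker, infl_cocycleClass G N 4 y ⟨_, hy⟩ rfl] at hc
    obtain ⟨α, hα⟩ := (cocycleClass_eq_zero_iff G 3 _).1 hc
    refine ⟨QuotientAddGroup.mk ⟨α, ⟨y.1, hα.symm⟩⟩, ?_⟩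
    rw [emergentAnomaly_mk]
    congr 1
    refine Subtype.ext (inflCochain_injective G N 4 ?_)
    rw [inflCochain_anomalyCochain, hα]

theorem emergentAnomaly_weakGSPT (z : (cobd 3 G).ker) :
    emergentAnomaly G N (weakGSPT G N z) = 0 := by
  refine (emergentAnomaly_mk G N (AddSubgroup.inclusion (ker_cobd_le_decorations G N) z)).trans ?_
  rw [← map_zero (cocycleClass (G ⧸ N) 4)]
  congr 1
  refine Subtype.ext (inflCochain_injective G N 4 ?_)
  rw [inflCochain_anomalyCochain]
  exact (AddMonoidHom.mem_ker.1 z.2).trans (map_zero _).symm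

/-- If the anomaly cocycle is `dβ`, then `α - pr*β` is closed and represents the same gSPT. -/
theorem exists_weakGSPT (x : GSPT G N) (hx : emergentAnomaly G N x = 0) :
    ∃ z, weakGSPT G N z = x := by
  induction x using QuotientAddGroup.induction_on with | H α => ?_
  rw [emergentAnomaly_mk] at hx
  obtain ⟨β, hβ⟩ := (cocycleClass_eq_zero_iff _ 3 _).1 hx
  have hβ : cobd 3 (G ⧸ N) β = anomalyCochain G N α := hβ
  have hz : α.1 - inflCochain G N 3 β ∈ (cobd 3 G).ker := by
    rw [AddMonoidHom.mem_ker, map_sub, cobd_inflCochain, hβ, inflCochain_anomalyCochain, sub_self]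
  refine ⟨⟨_, hz⟩, ?_⟩
  refine (QuotientAddGroup.eq (s := (trivialDecorations G N).addSubgroupOf (decorations G N))).2 ?_
  rw [AddSubgroup.mem_addSubgroupOf]
  refine AddSubgroup.mem_sup_right ⟨β, ?_⟩
  change _ = -(α.1 - inflCochain G N 3 β) + α.1
  abel

/-- The classification of gapless SPTs only depends on the two factors as groups. -/
theorem hasClassification_of_equiv {W E : Type} [AddCommGroup W] [AddCommGroup E]
    (w : WeakFactor G N ≃+ W) (e : AnomalyFactor G N ≃+ E) : HasClassification G N W E := by
  have hmem : ∀ x, emergentAnomaly G N x ∈ (infl G N 4).ker := fun x => by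
    rw [← emergentAnomaly_range]; exact ⟨x, rfl⟩
  have hσ : ∀ c : AnomalyFactor G N, ∃ x, emergentAnomaly G N x = c.1 := fun c =>
    (SetLike.ext_iff.1 (emergentAnomaly_range G N) c.1).2 c.2
  -- `σ` is only a set-theoretic section, which is why the classification asserts a bijection and
  -- not a group isomorphism.
  choose σ hσ using hσ
  have hz : ∀ x, ∃ z, weakGSPT G N z = x - σ ⟨_, hmem x⟩ := fun x =>
    exists_weakGSPT G N _ (by rw [map_sub, hσ, sub_self])
  choose z hz using hz
  -- The chosen cocycle `z x` is ambiguous, but its class in the weak factor is not.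
  have hcongr : ∀ z z', weakGSPT G N z = weakGSPT G N z' ↔ weakClass G N z = weakClass G N z' :=
    fun z z' => by
      have h := weakGSPT_eq_zero_iff G N (z - z')
      rwa [map_sub, map_sub, sub_eq_zero, sub_eq_zero] at h
  have hanom : ∀ x z, emergentAnomaly G N (x + weakGSPT G N z) = emergentAnomaly G N x :=
    fun x z => by rw [map_add, emergentAnomaly_weakGSPT, add_zero]
  have htrans : ∀ x y, weakClass G N (z (x + weakGSPT G N y)) =
      weakClass G N (z x) + weakClass G N y := fun x y => by
    rw [← map_add, ← hcongr, map_add, hz, hz]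
    simp only [hanom]
    abel
  let F : GSPT G N → W × E := fun x => (w (weakClass G N (z x)), e ⟨_, hmem x⟩)
  have hF : Function.Bijective F := by
    constructor
    · intro x y hxy
      have h1 := (hcongr _ _).2 (w.injective (congrArg Prod.fst hxy))
      have h2 : (⟨_, hmem x⟩ : AnomalyFactor G N) = ⟨_, hmem y⟩ :=
        e.injective (congrArg Prod.snd hxy)
      rw [hz, hz, h2] at h1
      exact sub_left_injective h1
    · rintro ⟨a, b⟩
      obtain ⟨c, hc⟩ := weakClass_surjective G N (w.symm a)
      refine ⟨σ (e.symm b) + weakGSPT G N (c - z (σ (e.symm b))), ?_⟩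
      refine Prod.ext ?_ ?_
      · change w (weakClass G N (z _)) = a
        rw [htrans, ← map_add, add_sub_cancel, hc, AddEquiv.apply_symm_apply]
      · change e ⟨_, _⟩ = b
        rw [← e.eq_symm_apply]
        exact Subtype.ext ((hanom _ _).trans (hσ _))
  refine ⟨w, e, Equiv.ofBijective F hF, fun x => ?_, fun x y => ?_⟩
  · change _ = ((e.symm (e ⟨_, hmem x⟩) : AnomalyFactor G N) : Cohomology 4 (G ⧸ N))
    rw [AddEquiv.symm_apply_apply]
  · refine Prod.ext ?_ ?_
    · change w (weakClass G N (z _)) = _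
      rw [htrans, map_add]
      rfl
    · exact congrArg e (Subtype.ext (hanom x y))

theorem hasIGSPT_iff : HasIGSPT G N ↔ (infl G N 4).ker ≠ ⊥ := by
  rw [← emergentAnomaly_range, Ne, AddSubgroup.eq_bot_iff_forall, HasIGSPT]
  simp

theorem hasIGSPT_iff_of_equiv {E : Type} [AddCommGroup E] (e : AnomalyFactor G N ≃+ E) :
    HasIGSPT G N ↔ Nontrivial E := by
  rw [hasIGSPT_iff, ← AddSubgroup.nontrivial_iff_ne_bot]
  exact e.toEquiv.nontrivial_congr

end Classification

/-! ### The bar resolution and its contraction -/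

section Bar

variable (G : Type) [Group G]

/-- The augmentation `ℤ[G] → ℤ`. -/
def aug : MonoidAlgebra ℤ G →+* ℤ := (MonoidAlgebra.lift ℤ ℤ G 1 : MonoidAlgebra ℤ G →ₐ[ℤ] ℤ)

@[simp] theorem aug_of (g : G) : aug G (of ℤ G g) = 1 := by simp [aug]

/-- The inhomogeneous bar resolution in degree `n`, free on `Gⁿ`. -/
abbrev Bar (n : ℕ) : Type := (Fin n → G) →₀ MonoidAlgebra ℤ G

variable {G}

/-- Basis element `g[v₁|…|vₙ]` of the bar resolution as an abelian group. -/
def barElt {n : ℕ} (g : G) (v : Fin n → G) : Bar G n := Finsupp.single v (of ℤ G g)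

theorem smul_barElt {n : ℕ} (g h : G) (v : Fin n → G) :
    of ℤ G g • barElt h v = barElt (g * h) v := by
  simp [barElt, MonoidAlgebra.single_mul_single]

theorem bar_addHom_ext {n : ℕ} {M : Type*} [AddCommGroup M] {f f' : Bar G n →+ M}
    (h : ∀ g v, f (barElt g v) = f' (barElt g v)) : f = f' := by
  refine Finsupp.addHom_ext' fun v => MonoidAlgebra.addMonoidHom_ext fun g r => ?_
  have e : single g r = r • of ℤ G g := by simp
  rw [e, map_zsmul, map_zsmul]
  exact congrArg (r • ·) (h g v)

/-- The extension of a cochain to the bar resolution. -/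
def evalBar {A : Type*} [AddCommGroup A] {n : ℕ} (c : (Fin n → G) → A) : Bar G n →ₛₗ[aug G] A where
  toFun b := b.sum fun v r => aug G r • c v
  map_add' b b' := Finsupp.sum_add_index' (h := fun v r => aug G r • c v) (by simp)
    (by simp [add_smul])
  map_smul' r b := by
    refine (Finsupp.sum_smul_index (h := fun v r => aug G r • c v) (by simp)).trans ?_
    simp [Finsupp.smul_sum, mul_smul]

theorem evalBar_barElt {A : Type*} [AddCommGroup A] {n : ℕ} (c : (Fin n → G) → A) (g : G)
    (v : Fin n → G) : evalBar c (barElt g v) = c v := by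
  change Finsupp.sum (Finsupp.single v (of ℤ G g)) (fun v r => aug G r • c v) = _
  rw [Finsupp.sum_single_index] <;> simp [-MonoidAlgebra.of_apply]

/-- Cochains with trivial coefficients are the same as `aug`-semilinear maps out of the bar
resolution; this direction lets any such map be treated as a cochain. -/
theorem evalBar_eq {A : Type*} [AddCommGroup A] {n : ℕ} (f : Bar G n →ₛₗ[aug G] A) :
    evalBar (fun v => f (barElt 1 v)) = f := by
  have h : (evalBar (fun v => f (barElt 1 v))).toAddMonoidHom = f.toAddMonoidHom :=
    bar_addHom_ext fun g v => by
      change evalBar (fun v => f (barElt 1 v)) (barElt g v) = f (barElt g v)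
      rw [evalBar_barElt, ← mul_one g, ← smul_barElt, map_smulₛₗ, aug_of, one_smul]
  exact LinearMap.ext fun x => DFunLike.congr_fun h x

/-- The augmentation of the bar resolution. -/
def barAug : Bar G 0 →ₛₗ[aug G] ℤ := evalBar fun _ => 1

theorem barAug_barElt (g : G) (v : Fin 0 → G) : barAug (barElt g v) = 1 := evalBar_barElt _ _ _

/-- The boundary of the bar resolution on a basis element `[v₀|…|vₙ]`. -/
def barBoundaryElt {n : ℕ} (v : Fin (n + 1) → G) : Bar G n :=
  barElt (v 0) (Fin.tail v) +
    ∑ j : Fin (n + 1), (-1 : ℤ) ^ ((j : ℕ) + 1) • barElt 1 (Fin.contractNth j (· * ·) v)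

/-- The boundary of the bar resolution. -/
def barD (n : ℕ) : Bar G (n + 1) →ₗ[MonoidAlgebra ℤ G] Bar G n :=
  Finsupp.linearCombination _ barBoundaryElt

theorem barD_barElt {n : ℕ} (g : G) (v : Fin (n + 1) → G) :
    barD n (barElt g v) = barElt (g * v 0) (Fin.tail v) +
      ∑ j : Fin (n + 1), (-1 : ℤ) ^ ((j : ℕ) + 1) • barElt g (Fin.contractNth j (· * ·) v) := by
  rw [barD, barElt, Finsupp.linearCombination_single, barBoundaryElt, smul_add, smul_barElt,
    Finset.smul_sum]
  congr 1
  refine Finset.sum_congr rfl fun j _ => ?_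
  rw [smul_comm, smul_barElt, mul_one]

/-- The contraction `g[v₁|…|vₙ] ↦ [g|v₁|…|vₙ]` of the bar resolution. -/
def barS (n : ℕ) : Bar G n →+ Bar G (n + 1) :=
  Finsupp.liftAddHom fun v => (Finsupp.liftAddHom fun g =>
    (zmultiplesHom (Bar G (n + 1))) (barElt 1 (Fin.cons g v))).comp
      (MonoidAlgebra.coeffAddEquiv (R := ℤ) (M := G)).toAddMonoidHom

theorem barS_barElt {n : ℕ} (g : G) (v : Fin n → G) :
    barS n (barElt g v) = barElt 1 (Fin.cons g v : Fin (n + 1) → G) := by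
  simp [barS, barElt]

theorem contractNth_zero_cons {n : ℕ} (g : G) (v : Fin (n + 1) → G) :
    Fin.contractNth 0 (· * ·) (Fin.cons g v : Fin (n + 2) → G) =
      Fin.cons (g * v 0) (Fin.tail v) := by
  funext k
  refine Fin.cases ?_ (fun k => ?_) k
  · rw [Fin.contractNth_apply_of_eq _ _ _ _ rfl]; rfl
  · rw [Fin.contractNth_apply_of_gt _ _ _ _ (by simp)]; rfl

theorem contractNth_succ_cons {n : ℕ} (j : Fin (n + 1)) (g : G) (v : Fin (n + 1) → G) :
    Fin.contractNth j.succ (· * ·) (Fin.cons g v : Fin (n + 2) → G) =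
      Fin.cons g (Fin.contractNth j (· * ·) v) := by
  funext k
  refine Fin.cases ?_ (fun k => ?_) k
  · rw [Fin.contractNth_apply_of_lt _ _ _ _ (by simp)]; rfl
  · rcases lt_trichotomy (k : ℕ) j with h | h | h
    · rw [Fin.contractNth_apply_of_lt _ _ _ _ (by simpa using h), Fin.cons_succ,
        Fin.contractNth_apply_of_lt _ _ _ _ h]; rfl
    · rw [Fin.contractNth_apply_of_eq _ _ _ _ (by simpa using h), Fin.cons_succ, Fin.cons_succ,
        Fin.contractNth_apply_of_eq _ _ _ _ h]; rfl
    · rw [Fin.contractNth_apply_of_gt _ _ _ _ (by simpa using h), Fin.cons_succ, Fin.cons_succ,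
        Fin.contractNth_apply_of_gt _ _ _ _ h]

/-- On `g[v₀|…|vₙ]` the first face of `[g|v₀|…|vₙ]` returns the element itself, and the remaining
faces are those of the boundary shifted by one place, hence with opposite sign. -/
theorem barD_barS {n : ℕ} (b : Bar G (n + 1)) :
    barD (n + 1) (barS (n + 1) b) = b - barS n (barD n b) := by
  suffices h : (barD (n + 1)).toAddMonoidHom.comp (barS (n + 1)) =
      AddMonoidHom.id _ - (barS n).comp (barD n).toAddMonoidHom from DFunLike.congr_fun h b
  refine bar_addHom_ext fun g v => ?_
  change barD (n + 1) (barS (n + 1) (barElt g v)) = barElt g v - barS n (barD n (barElt g v))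
  rw [barS_barElt, barD_barElt, barD_barElt, map_add, barS_barElt, map_sum, Fin.sum_univ_succ,
    contractNth_zero_cons]
  simp only [contractNth_succ_cons, map_zsmul, barS_barElt, Fin.cons_zero, one_mul, Fin.tail_cons]
  simp [pow_succ]
  abel

theorem barD_barS_zero (b : Bar G 0) :
    barD 0 (barS 0 b) = b - barAug b • barElt 1 ![] := by
  suffices h : (barD 0).toAddMonoidHom.comp (barS 0) =
      AddMonoidHom.id _ - ((zmultiplesHom (Bar G 0)) (barElt 1 ![])).comp
        barAug.toAddMonoidHom from DFunLike.congr_fun h b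
  refine bar_addHom_ext fun g v => ?_
  change barD 0 (barS 0 (barElt g v)) = barElt g v - barAug (barElt g v) • barElt 1 ![]
  obtain rfl : v = ![] := Subsingleton.elim _ _
  rw [barAug_barElt, barS_barElt, barD_barElt, Fin.sum_univ_succ,
    Subsingleton.elim (Fin.tail (Fin.cons g ![] : Fin 1 → G)) ![],
    Subsingleton.elim (Fin.contractNth 0 (· * ·) (Fin.cons g ![] : Fin 1 → G)) ![]]
  simp [sub_eq_add_neg]

theorem barAug_barD (b : Bar G 1) : barAug (barD 0 b) = 0 := by
  suffices h : barAug.toAddMonoidHom.comp (barD (G := G) 0).toAddMonoidHom = 0 from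
    DFunLike.congr_fun h b
  refine bar_addHom_ext fun g v => ?_
  change barAug (barD 0 (barElt g v)) = 0
  rw [barD_barElt, map_add, map_sum, Fin.sum_univ_succ]
  simp [barAug_barElt]

/-- Each free generator lies in the image of the contraction `s`, and `∂s = 1 - s∂` gives `∂∂s =
s∂∂`. The induction starts from `barAug_barD`. -/
theorem barD_barD (n : ℕ) (b : Bar G (n + 2)) : barD n (barD (n + 1) b) = 0 := by
  induction n with
  | zero =>
    suffices h : (barD 0 ∘ₗ barD 1) = (0 : Bar G 2 →ₗ[MonoidAlgebra ℤ G] Bar G 0) from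
      LinearMap.congr_fun h b
    refine Finsupp.lhom_ext' fun v => LinearMap.ext_ring ?_
    change barD 0 (barD 1 (barElt 1 v)) = 0
    rw [← Fin.cons_self_tail v, ← barS_barElt, barD_barS, map_sub, barD_barS_zero, barAug_barD]
    simp
  | succ n ih =>
    suffices h : (barD (n + 1) ∘ₗ barD (n + 2)) =
        (0 : Bar G (n + 3) →ₗ[MonoidAlgebra ℤ G] Bar G (n + 1)) from LinearMap.congr_fun h b
    refine Finsupp.lhom_ext' fun v => LinearMap.ext_ring ?_
    change barD (n + 1) (barD (n + 2) (barElt 1 v)) = 0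
    rw [← Fin.cons_self_tail v, ← barS_barElt, barD_barS, map_sub, barD_barS, ih]
    simp

/-- Identifies the inhomogeneous cochain complex with the semilinear dual of the bar resolution. -/
theorem evalBar_cobd (n : ℕ) (c : Cochain n G) :
    evalBar (A := Additive ℂˣ) (cobd n G c) = (evalBar (A := Additive ℂˣ) c).comp (barD n) := by
  rw [← evalBar_eq ((evalBar (A := Additive ℂˣ) c).comp (barD n))]
  congr 1
  funext v
  rw [cobd_apply, LinearMap.comp_apply, barD_barElt]
  simp only [map_add, map_sum, map_zsmul, evalBar_barElt]

end Bar

/-! ### The small resolution and its comparison with the bar resolution -/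

/-- Elements of `ℤ[G]` defining a free resolution of `ℤ` which is the total complex of a double
complex with one generator in each bidegree `(i, j)`; the differentials are right multiplications
by `ξ i : (i + 1, j) → (i, j)` and, up to sign, `η i j : (i, j + 1) → (i, j)`. -/
structure BicyclicResolution (G : Type) [Group G] where
  ξ : ℕ → MonoidAlgebra ℤ G
  η : ℕ → ℕ → MonoidAlgebra ℤ G
  ξ_mul_ξ : ∀ i, ξ (i + 1) * ξ i = 0
  η_mul_η : ∀ i j, η i (j + 1) * η i j = 0
  ξ_mul_η : ∀ i j, ξ i * η i j = η (i + 1) j * ξ i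
  aug_ξ_zero : aug G (ξ 0) = 0
  aug_η_zero : aug G (η 0 0) = 0
  exact_ξ : ∀ i r, r * ξ i = 0 → ∃ t, r = t * ξ (i + 1)
  exact_η : ∀ j r t, r * η 0 j = t * ξ 0 → ∃ s s', r = s * η 0 (j + 1) + s' * ξ 0
  exact_aug : ∀ r, aug G r = 0 → ∃ s s', r = s * η 0 0 + s' * ξ 0

namespace BicyclicResolution

variable {G : Type} [Group G] (P : BicyclicResolution G)

/-- The differential of the resolution. -/
def d (n : ℕ) : (Fin (n + 2) → MonoidAlgebra ℤ G) →ₗ[MonoidAlgebra ℤ G]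
    (Fin (n + 1) → MonoidAlgebra ℤ G) where
  toFun c i := c i.succ * P.ξ i + (-1 : ℤ) ^ (i : ℕ) • (c i.castSucc * P.η i (n - i))
  map_add' c c' := by
    funext i
    simp only [Pi.add_apply, add_mul, smul_add]
    abel
  map_smul' r c := by
    funext i
    simp only [Pi.smul_apply, smul_eq_mul, mul_assoc, RingHom.id_apply, mul_add, mul_smul_comm]

theorem d_apply (n : ℕ) (c : Fin (n + 2) → MonoidAlgebra ℤ G) (i : Fin (n + 1)) :
    P.d n c i = c i.succ * P.ξ i + (-1 : ℤ) ^ (i : ℕ) • (c i.castSucc * P.η i (n - i)) := rfl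

theorem d_d (n : ℕ) (c : Fin (n + 3) → MonoidAlgebra ℤ G) : P.d n (P.d (n + 1) c) = 0 := by
  funext i
  have h1 : n + 1 - (i.succ : ℕ) = n - i := by simp
  have h2 : n + 1 - (i.castSucc : ℕ) = (n - i) + 1 := by
    have := i.2
    simp
    omega
  rw [d_apply, d_apply, d_apply, h1, h2]
  simp only [Fin.val_succ, Fin.val_castSucc, add_mul, smul_mul_assoc, mul_assoc, P.ξ_mul_ξ,
    P.η_mul_η, P.ξ_mul_η, Fin.succ_castSucc, pow_succ]
  simp

/-- The staircase argument for exactness in positive degrees. -/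
theorem d_exact (n : ℕ) (c : Fin (n + 2) → MonoidAlgebra ℤ G) (hc : P.d n c = 0) :
    ∃ b, P.d (n + 1) b = c := by
  have key : ∀ k : ℕ, k ≤ n + 1 → ∃ b : ℕ → MonoidAlgebra ℤ G, ∀ i (hi : i < n + 2), i ≤ k →
      c ⟨i, hi⟩ = b (i + 1) * P.ξ i + (-1 : ℤ) ^ i • (b i * P.η i (n + 1 - i)) := by
    intro k
    induction k with
    | zero =>
      intro _
      have h := congrFun hc 0
      rw [d_apply] at h
      -- The column `i = 0` is exact only modulo multiples of `ξ 0`; this yields the first two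
      -- components of the preimage together.
      obtain ⟨s, s', h'⟩ := P.exact_η n (c 0) (-c (Fin.succ 0)) (by
        simp only [Fin.val_zero, pow_zero, one_smul, Nat.sub_zero, Fin.castSucc_zero] at h
        rw [neg_mul, eq_neg_iff_add_eq_zero, add_comm]
        exact h)
      refine ⟨fun i => if i = 0 then s else s', fun i hi hi0 => ?_⟩
      obtain rfl : i = 0 := by omega
      simpa [add_comm] using h'
    | succ k ih =>
      intro hk
      obtain ⟨b, hb⟩ := ih (by omega)
      have h := congrFun hc ⟨k, by omega⟩
      have hbk := hb k (by omega) le_rfl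
      rw [d_apply] at h
      have e : n + 1 - k = (n - k) + 1 := by omega
      -- Components `k` and `k + 1` are already fixed. The equation `d c = 0` shows that the error
      -- left at position `k + 1` is annihilated by `ξ k`, so the new component `k + 2` can absorb
      -- it.
      obtain ⟨t, ht⟩ := P.exact_ξ k (c ⟨k + 1, by omega⟩ -
        (-1 : ℤ) ^ (k + 1) • (b (k + 1) * P.η (k + 1) (n - k))) (by
        have h' : c ⟨k + 1, by omega⟩ * P.ξ k +
          (-1 : ℤ) ^ k • (c ⟨k, by omega⟩ * P.η k (n - k)) = 0 := h
        rw [hbk, e] at h'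
        simp only [add_mul, smul_mul_assoc, mul_assoc, P.η_mul_η, P.ξ_mul_η] at h'
        simp only [sub_mul, smul_mul_assoc, mul_assoc, pow_succ]
        rw [← h']
        simp [sub_eq_add_neg])
      refine ⟨Function.update b (k + 2) t, fun i hi hik => ?_⟩
      rcases Nat.lt_or_ge i (k + 1) with h1 | h1
      · rw [Function.update_of_ne (by omega), Function.update_of_ne (by omega)]
        exact hb i hi (by omega)
      · obtain rfl : i = k + 1 := by omega
        rw [Function.update_self, Function.update_of_ne (by omega), ← ht]
        simp
  obtain ⟨b, hb⟩ := key (n + 1) le_rfl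
  refine ⟨fun i => b i, funext fun i => ?_⟩
  rw [d_apply]
  exact (hb i i.2 (by omega)).symm

theorem d_exact_zero (c : Fin 1 → MonoidAlgebra ℤ G) (hc : aug G (c 0) = 0) :
    ∃ b, P.d 0 b = c := by
  obtain ⟨s, s', h⟩ := P.exact_aug _ hc
  refine ⟨![s, s'], funext fun i => ?_⟩
  obtain rfl : i = 0 := Fin.fin_one_eq_zero i
  rw [d_apply, h]
  simp [add_comm]

theorem aug_d_zero (c : Fin 2 → MonoidAlgebra ℤ G) : aug G (P.d 0 c 0) = 0 := by
  rw [d_apply]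
  simp [P.aug_ξ_zero, P.aug_η_zero]

/-- The comparison map to the bar resolution. -/
def toBar : ∀ n, (Fin (n + 1) → MonoidAlgebra ℤ G) →ₗ[MonoidAlgebra ℤ G] Bar G n
  | 0 => Fintype.linearCombination _ fun _ => barElt 1 ![]
  | n + 1 => Fintype.linearCombination _ fun i => barS n (toBar n (P.d n (Pi.single i 1)))

theorem toBar_zero (c : Fin 1 → MonoidAlgebra ℤ G) : P.toBar 0 c = c 0 • barElt 1 ![] := by
  simp [toBar, Fintype.linearCombination_apply]

theorem toBar_single (n : ℕ) (i : Fin (n + 2)) :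
    P.toBar (n + 1) (Pi.single i 1) = barS n (P.toBar n (P.d n (Pi.single i 1))) := by
  rw [toBar, Fintype.linearCombination_apply_single, one_smul]

/-- By induction the image of the boundary of a generator is a cycle (of augmentation zero in degree
zero), and the contraction fills it. -/
theorem barD_toBar (n : ℕ) (c : Fin (n + 2) → MonoidAlgebra ℤ G) :
    barD n (P.toBar (n + 1) c) = P.toBar n (P.d n c) := by
  suffices h : barD n ∘ₗ P.toBar (n + 1) = P.toBar n ∘ₗ P.d n from LinearMap.congr_fun h c
  refine LinearMap.pi_ext' fun i => LinearMap.ext_ring ?_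
  change barD n (P.toBar (n + 1) (Pi.single i 1)) = P.toBar n (P.d n (Pi.single i 1))
  rw [toBar_single]
  cases n with
  | zero =>
    have h : barAug (P.toBar 0 (P.d 0 (Pi.single i 1))) = 0 := by
      rw [toBar_zero, map_smulₛₗ, barAug_barElt, aug_d_zero, zero_smul]
    rw [barD_barS_zero, h, zero_smul, sub_zero]
  | succ n => rw [barD_barS, barD_toBar n, d_d, map_zero, map_zero, sub_zero]

/-- There is a chain map from the bar resolution which is a homotopy inverse of `toBar`. -/
theorem exists_homotopyInverse :
    ∃ f : ∀ n, Bar G n →ₗ[MonoidAlgebra ℤ G] (Fin (n + 1) → MonoidAlgebra ℤ G),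
      (∀ n x, P.d n (f (n + 1) x) = f n (barD n x)) ∧
      (∃ h : ∀ n, Bar G n →ₗ[MonoidAlgebra ℤ G] Bar G (n + 1),
        ∀ n x, barD (n + 1) (h (n + 1) x) + h n (barD n x) =
          P.toBar (n + 1) (f (n + 1) x) - x) ∧
      (∃ h : ∀ n, (Fin (n + 1) → MonoidAlgebra ℤ G) →ₗ[MonoidAlgebra ℤ G]
          (Fin (n + 2) → MonoidAlgebra ℤ G),
        ∀ n x, P.d (n + 1) (h (n + 1) x) + h n (P.d n x) =
          f (n + 1) (P.toBar (n + 1) x) - x) := by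
  have hv : ∀ v : Fin 0 → G, v = ![] := fun v => Subsingleton.elim _ _
  let f₀ : Bar G 0 →ₗ[MonoidAlgebra ℤ G] (Fin 1 → MonoidAlgebra ℤ G) :=
    LinearMap.pi fun _ => Finsupp.lapply ![]
  have hf₀ : ∀ b, aug G (f₀ b 0) = barAug b := fun b => by
    suffices h : (aug G).toAddMonoidHom.comp (Finsupp.applyAddHom ![]) =
      (barAug (G := G)).toAddMonoidHom from DFunLike.congr_fun h b
    refine bar_addHom_ext fun g v => ?_
    change aug G (barElt g v ![]) = barAug (barElt g v)
    rw [barAug_barElt, hv v, barElt, Finsupp.single_eq_same, aug_of]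
  obtain ⟨f, hf0, hf⟩ := exists_chainMap (R := MonoidAlgebra ℤ G) (X := Bar G)
    (Y := fun n => Fin (n + 1) → MonoidAlgebra ℤ G) barD P.d barD_barD P.d_exact f₀
    (fun x => P.d_exact_zero _ (by rw [hf₀, barAug_barD]))
  refine ⟨f, hf, ?_, ?_⟩
  -- Both composites are the identity in degree zero, so each homotopy can start from zero.
  · refine exists_homotopy (R := MonoidAlgebra ℤ G) (X := Bar G) (Y := Bar G) barD barD barD_barD
      (fun n y hy => ⟨barS _ y, by rw [barD_barS, hy, map_zero, sub_zero]⟩)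
      (fun n => P.toBar n ∘ₗ f n - LinearMap.id) (fun n x => ?_) (fun x => ⟨0, ?_⟩)
    · simp [barD_toBar, hf]
    · rw [hf0, map_zero]
      have h : P.toBar 0 ∘ₗ f₀ = LinearMap.id := by
        refine Finsupp.lhom_ext' fun v => LinearMap.ext_ring ?_
        change P.toBar 0 (f₀ (Finsupp.single v 1)) = Finsupp.single v 1
        rw [toBar_zero, hv v]
        simp [f₀, barElt, MonoidAlgebra.one_def]
      simp [h]
  · refine exists_homotopy (R := MonoidAlgebra ℤ G) (X := fun n => Fin (n + 1) → MonoidAlgebra ℤ G)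
      (Y := fun n => Fin (n + 1) → MonoidAlgebra ℤ G) P.d P.d P.d_d P.d_exact
      (fun n => f n ∘ₗ P.toBar n - LinearMap.id) (fun n x => ?_) (fun x => ⟨0, ?_⟩)
    · simp [barD_toBar, hf]
    · rw [hf0, map_zero]
      funext i
      obtain rfl : i = 0 := Fin.fin_one_eq_zero i
      rw [LinearMap.sub_apply, LinearMap.comp_apply, toBar_zero]
      simp [f₀, barElt, ← MonoidAlgebra.one_def]

/-- The cochain complex of the resolution with coefficients in a trivial module. -/
def evalP {A : Type*} [AddCommGroup A] {n : ℕ} (k : Fin (n + 1) → A) :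
    (Fin (n + 1) → MonoidAlgebra ℤ G) →ₛₗ[aug G] A where
  toFun c := ∑ i, aug G (c i) • k i
  map_add' c c' := by simp [add_smul, Finset.sum_add_distrib]
  map_smul' r c := by simp [mul_smul, Finset.smul_sum]

theorem evalP_apply {A : Type*} [AddCommGroup A] {n : ℕ} (k : Fin (n + 1) → A)
    (c : Fin (n + 1) → MonoidAlgebra ℤ G) : evalP k c = ∑ i, aug G (c i) • k i := rfl

theorem evalP_single {A : Type*} [AddCommGroup A] {n : ℕ} (k : Fin (n + 1) → A) (i : Fin (n + 1)) :
    evalP (G := G) k (Pi.single i 1) = k i := by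
  rw [evalP_apply, Finset.sum_eq_single i (fun j _ h => by simp [h]) (by simp)]
  simp

theorem sum_smul_single {R : Type*} [Ring R] {n : ℕ} (c : Fin n → R) :
    ∑ i, c i • (Pi.single i 1 : Fin n → R) = c := by
  simpa using (pi_eq_sum_univ' c).symm

theorem evalP_eq {A : Type*} [AddCommGroup A] {n : ℕ}
    (f : (Fin (n + 1) → MonoidAlgebra ℤ G) →ₛₗ[aug G] A) :
    evalP (fun i => f (Pi.single i 1)) = f := by
  refine LinearMap.ext fun c => ?_
  conv_rhs => rw [← sum_smul_single c, map_sum]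
  simp only [map_smulₛₗ]
  rfl

variable {A : Type*} [AddCommGroup A]

/-- The differential of the cochain complex of the resolution. -/
def δ (A : Type*) [AddCommGroup A] (n : ℕ) : (Fin (n + 1) → A) →+ (Fin (n + 2) → A) where
  toFun k i := ∑ j : Fin (n + 1), aug G (P.d n (Pi.single i 1) j) • k j
  map_zero' := by simp; rfl
  map_add' k k' := by funext i; simp [Finset.sum_add_distrib]

theorem evalP_δ (n : ℕ) (k : Fin (n + 1) → A) : evalP (P.δ A n k) = (evalP k).comp (P.d n) :=
  evalP_eq ((evalP k).comp (P.d n))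

/-- Restriction of cochains along the comparison map. -/
def compare (n : ℕ) : Cochain n G →+ (Fin (n + 1) → Additive ℂˣ) where
  toFun c i := evalBar (A := Additive ℂˣ) c (P.toBar n (Pi.single i 1))
  map_zero' := by
    funext i
    have h : evalBar (G := G) (A := Additive ℂˣ) (fun v => (0 : Bar G n →ₛₗ[aug G] Additive ℂˣ)
      (barElt 1 v)) = 0 := evalBar_eq _
    exact LinearMap.congr_fun h _
  map_add' c c' := by
    funext i
    have h := evalBar_eq (evalBar (A := Additive ℂˣ) c + evalBar (A := Additive ℂˣ) c')
    simp only [LinearMap.add_apply, evalBar_barElt] at h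
    exact LinearMap.congr_fun h _

theorem evalP_compare (n : ℕ) (c : Cochain n G) :
    evalP (P.compare n c) = (evalBar (A := Additive ℂˣ) c).comp (P.toBar n) :=
  evalP_eq ((evalBar (A := Additive ℂˣ) c).comp (P.toBar n))

theorem compare_cobd (n : ℕ) (c : Cochain n G) :
    P.compare (n + 1) (cobd n G c) = P.δ _ n (P.compare n c) := by
  funext i
  rw [← evalP_single (G := G) (P.δ _ n _), evalP_δ, evalP_compare]
  change evalBar (A := Additive ℂˣ) (cobd n G c) _ = _
  rw [evalBar_cobd, LinearMap.comp_apply, barD_toBar]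
  rfl

/-- Injectivity of the comparison on cohomology. With `toBar ∘ f = 1 + ∂h + h∂` and `c∂ = 0`, the
relation `c ∘ toBar = k d` becomes `c = (k f - c h)∂`. -/
theorem exists_cobd_of_compare (n : ℕ) (c : Cochain (n + 1) G) (hc : cobd (n + 1) G c = 0)
    (k : Fin (n + 1) → Additive ℂˣ) (hk : P.compare (n + 1) c = P.δ _ n k) :
    ∃ x, cobd n G x = c := by
  obtain ⟨f, hf, ⟨h, hh⟩, -⟩ := P.exists_homotopyInverse
  let F : Bar G n →ₛₗ[aug G] Additive ℂˣ :=
    (evalP k).comp (f n) - (evalBar (A := Additive ℂˣ) c).comp (h n)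
  refine ⟨fun v => F (barElt 1 v), funext fun v => ?_⟩
  have e1 := evalBar_cobd n (fun v => F (barElt 1 v))
  have e2 : evalBar (A := Additive ℂˣ) (cobd (n + 1) G c) = 0 := by
    rw [hc]
    exact evalBar_eq 0
  rw [evalBar_cobd] at e2
  rw [evalBar_eq] at e1
  have e3 := LinearMap.congr_fun (P.evalP_compare (n + 1) c) (f (n + 1) (barElt 1 v))
  rw [hk, evalP_δ, LinearMap.comp_apply, LinearMap.comp_apply, hf,
    sub_eq_iff_eq_add.1 (hh n (barElt 1 v)).symm, map_add, map_add] at e3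
  have e4 := LinearMap.congr_fun e2 (h (n + 1) (barElt 1 v))
  have e5 := LinearMap.congr_fun e1 (barElt 1 v)
  rw [evalBar_barElt] at e3 e5
  rw [LinearMap.comp_apply, LinearMap.zero_apply] at e4
  rw [e4, zero_add] at e3
  rw [e5]
  change evalP k (f n (barD n (barElt 1 v))) -
    evalBar (A := Additive ℂˣ) c (h n (barD n (barElt 1 v))) = c v
  rw [e3, add_sub_cancel_left]

/-- Surjectivity of the comparison on cohomology: take `c = k ∘ f`. Restricting it back gives `k +
k(dh + hd)`, and `k d = 0`, so `l = k ∘ h`. -/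
theorem exists_compare (n : ℕ) (k : Fin (n + 2) → Additive ℂˣ) (hk : P.δ _ (n + 1) k = 0) :
    ∃ c : Cochain (n + 1) G, cobd (n + 1) G c = 0 ∧
      ∃ l, P.compare (n + 1) c = k + P.δ _ n l := by
  obtain ⟨f, hf, -, ⟨h, hh⟩⟩ := P.exists_homotopyInverse
  have hk' : (evalP (G := G) k).comp (P.d (n + 1)) = 0 := by
    rw [← evalP_δ, hk]
    exact evalP_eq 0
  have hk' : ∀ x, evalP k (P.d (n + 1) x) = 0 := fun x => LinearMap.congr_fun hk' x
  let F : Bar G (n + 1) →ₛₗ[aug G] Additive ℂˣ := (evalP k).comp (f (n + 1))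
  have e1 : evalBar (A := Additive ℂˣ) (fun v => F (barElt 1 v)) = F := evalBar_eq F
  refine ⟨fun v => F (barElt 1 v), funext fun v => ?_, fun i => evalP k (h n (Pi.single i 1)),
    funext fun i => ?_⟩
  · have e2 := LinearMap.congr_fun (evalBar_cobd (n + 1) (fun v => F (barElt 1 v))) (barElt 1 v)
    rw [evalBar_barElt, e1] at e2
    refine e2.trans ?_
    change evalP k (f (n + 1) (barD (n + 1) (barElt 1 v))) = 0
    rw [← hf, hk']
  · change evalBar (A := Additive ℂˣ) (fun v => F (barElt 1 v))
      (P.toBar (n + 1) (Pi.single i 1)) = _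
    have e2 := LinearMap.congr_fun (evalP_eq ((evalP k).comp (h n))) (P.d n (Pi.single i 1))
    rw [e1, Pi.add_apply, ← evalP_single (G := G) (P.δ _ n _), evalP_δ]
    refine Eq.trans ?_ (congrArg (k i + ·) e2).symm
    change evalP k (f (n + 1) (P.toBar (n + 1) (Pi.single i 1))) =
      k i + evalP k (h n (P.d n (Pi.single i 1)))
    rw [sub_eq_iff_eq_add.1 (hh n _).symm, map_add, map_add, hk', zero_add, evalP_single, add_comm]

end BicyclicResolution

/-- Applied with `S` a group of bar cocycles, `X` the sought factor and `Y` its value read off from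
the small resolution. -/
theorem nonempty_addEquiv_of_surjective {S X Y : Type*} [AddCommGroup S] [AddCommGroup X]
    [AddCommGroup Y] (f : S →+ X) (g : S →+ Y) (hf : Function.Surjective f)
    (hg : Function.Surjective g) (h : ∀ s, f s = 0 ↔ g s = 0) : Nonempty (X ≃+ Y) :=
  ⟨(QuotientAddGroup.quotientKerEquivOfSurjective f hf).symm.trans
    ((QuotientAddGroup.quotientAddEquivOfEq (AddSubgroup.ext h)).trans
      (QuotientAddGroup.quotientKerEquivOfSurjective g hg))⟩

/-! ### Naturality of the two resolutions in the group -/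

section Functoriality

variable {G H : Type} [Group G] [Group H] (φ : G →* H)

/-- The ring homomorphism `ℤ[G] → ℤ[H]`. -/
abbrev ringMap : MonoidAlgebra ℤ G →+* MonoidAlgebra ℤ H := MonoidAlgebra.mapDomainRingHom ℤ φ

theorem ringMap_of (g : G) : ringMap φ (of ℤ G g) = of ℤ H (φ g) := by simp

theorem aug_ringMap (r : MonoidAlgebra ℤ G) : aug H (ringMap φ r) = aug G r := by
  suffices h : (aug H).toAddMonoidHom.comp (ringMap φ).toAddMonoidHom = (aug G).toAddMonoidHom from
    DFunLike.congr_fun h r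
  refine MonoidAlgebra.addMonoidHom_ext fun g r => ?_
  simp [aug]

/-- Functoriality of the bar resolution. -/
def barMap (n : ℕ) : Bar G n →ₛₗ[ringMap φ] Bar H n where
  toFun b := b.sum fun (v : Fin n → G) r => Finsupp.single (fun i => φ (v i)) (ringMap φ r)
  map_add' b b' := Finsupp.sum_add_index'
    (h := fun (v : Fin n → G) r => Finsupp.single (fun i => φ (v i)) (ringMap φ r)) (by simp)
    fun v r r' => by rw [map_add, Finsupp.single_add]
  map_smul' r b := by
    refine (Finsupp.sum_smul_index
      (h := fun (v : Fin n → G) r => Finsupp.single (fun i => φ (v i)) (ringMap φ r))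
      (by simp)).trans ?_
    simp only [map_mul, Finsupp.smul_sum, Finsupp.smul_single, smul_eq_mul]

theorem barMap_barElt {n : ℕ} (g : G) (v : Fin n → G) :
    barMap φ n (barElt g v) = barElt (φ g) (fun i => φ (v i)) := by
  change Finsupp.sum (Finsupp.single v (of ℤ G g))
    (fun (v : Fin n → G) r => Finsupp.single (fun i => φ (v i)) (ringMap φ r)) = _
  rw [Finsupp.sum_single_index (by simp), ringMap_of]
  rfl

theorem barMap_barS (n : ℕ) (b : Bar G n) :
    barMap φ (n + 1) (barS n b) = barS n (barMap φ n b) := by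
  suffices h : (barMap φ (n + 1)).toAddMonoidHom.comp (barS n) =
    (barS n).comp (barMap φ n).toAddMonoidHom from DFunLike.congr_fun h b
  refine bar_addHom_ext fun g v => ?_
  change barMap φ (n + 1) (barS n (barElt g v)) = barS n (barMap φ n (barElt g v))
  rw [barMap_barElt, barS_barElt, barS_barElt, barMap_barElt, map_one]
  congr 1
  funext i
  exact Fin.cases rfl (fun _ => rfl) i

theorem evalBar_barMap {A : Type*} [AddCommGroup A] {n : ℕ} (c : (Fin n → H) → A) (b : Bar G n) :
    evalBar c (barMap φ n b) = evalBar (fun v => c fun i => φ (v i)) b := by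
  suffices h : (evalBar c).toAddMonoidHom.comp (barMap φ n).toAddMonoidHom =
      (evalBar fun v => c fun i => φ (v i)).toAddMonoidHom from DFunLike.congr_fun h b
  refine bar_addHom_ext fun g v => ?_
  change evalBar c (barMap φ n (barElt g v)) = evalBar (fun v => c fun i => φ (v i)) (barElt g v)
  rw [barMap_barElt, evalBar_barElt, evalBar_barElt]

end Functoriality

namespace BicyclicResolution

/-- A map of bicyclic resolutions over `φ : G → H`, multiplying the generator in bidegree `(i, j)`
by the integer `s i`. -/
structure Hom {G H : Type} [Group G] [Group H] (φ : G →* H) (P : BicyclicResolution G)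
    (Q : BicyclicResolution H) (s : ℕ → ℤ) : Prop where
  s_zero : s 0 = 1
  map_ξ : ∀ i, s i • ringMap φ (P.ξ i) = s (i + 1) • Q.ξ i
  map_η : ∀ i j, ringMap φ (P.η i j) = Q.η i j

/-- The map on cochains induced by a map of resolutions. -/
def scale (A : Type*) [AddCommGroup A] (s : ℕ → ℤ) (n : ℕ) : (Fin n → A) →+ (Fin n → A) where
  toFun k i := s i • k i
  map_zero' := by funext; simp
  map_add' k k' := by funext; simp

@[simp] theorem scale_apply {A : Type*} [AddCommGroup A] (s : ℕ → ℤ) (n : ℕ) (k : Fin n → A)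
    (i : Fin n) : scale A s n k i = s i • k i := rfl

namespace Hom

variable {G H : Type} [Group G] [Group H] {φ : G →* H} {P : BicyclicResolution G}
    {Q : BicyclicResolution H} {s : ℕ → ℤ} (F : Hom φ P Q s)

include F

theorem map_d_single (n : ℕ) (i : Fin (n + 2)) (j : Fin (n + 1)) :
    s j • ringMap φ (P.d n (Pi.single i 1) j) = s i • Q.d n (Pi.single i 1) j := by
  have h : ∀ k : Fin (n + 2), ringMap φ ((Pi.single i 1 : Fin (n + 2) → MonoidAlgebra ℤ G) k) =
      (Pi.single i 1 : Fin (n + 2) → MonoidAlgebra ℤ H) k := fun k => by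
    rcases eq_or_ne k i with rfl | hk
    · simp
    · simp [hk]
  have hs : ∀ k : Fin (n + 2), s k • (Pi.single i 1 : Fin (n + 2) → MonoidAlgebra ℤ H) k =
      s i • (Pi.single i 1 : Fin (n + 2) → MonoidAlgebra ℤ H) k := fun k => by
    rcases eq_or_ne k i with rfl | hk
    · rfl
    · simp [hk]
  have h1 := hs j.succ
  have h2 := hs j.castSucc
  rw [Fin.val_succ] at h1
  rw [Fin.val_castSucc] at h2
  rw [d_apply, d_apply, map_add, map_zsmul, map_mul, map_mul, h, h, smul_add, smul_add,
    ← mul_smul_comm, F.map_ξ, F.map_η, mul_smul_comm, ← smul_mul_assoc, h1, smul_mul_assoc,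
    smul_comm (s j), ← smul_mul_assoc (s j), h2, smul_mul_assoc, smul_comm (s i)]

theorem δ_scale {A : Type*} [AddCommGroup A] (n : ℕ) (k : Fin (n + 1) → A) :
    P.δ A n (scale A s (n + 1) k) = scale A s (n + 2) (Q.δ A n k) := by
  funext i
  change ∑ j : Fin (n + 1), aug G (P.d n (Pi.single i 1) j) • s j • k j =
    s i • ∑ j : Fin (n + 1), aug H (Q.d n (Pi.single i 1) j) • k j
  rw [Finset.smul_sum]
  refine Finset.sum_congr rfl fun j _ => ?_
  have h := congrArg (aug H) (F.map_d_single n i j)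
  rw [map_zsmul, map_zsmul, aug_ringMap, smul_eq_mul, smul_eq_mul] at h
  rw [smul_smul, smul_smul, ← h, mul_comm]

/-- Holds on the nose and not merely up to homotopy, because `toBar` is built from the contraction,
which commutes with `barMap`. -/
theorem barMap_toBar (n : ℕ) (i : Fin (n + 1)) :
    barMap φ n (P.toBar n (Pi.single i 1)) = s i • Q.toBar n (Pi.single i 1) := by
  induction n with
  | zero =>
    obtain rfl : i = 0 := Fin.fin_one_eq_zero i
    rw [toBar_zero, toBar_zero, map_smulₛₗ, barMap_barElt, Fin.val_zero, F.s_zero,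
      Pi.single_eq_same, Pi.single_eq_same, one_smul, map_one, map_one]
    congr 1
    exact congrArg _ (Subsingleton.elim _ _)
  | succ n ih =>
    rw [toBar_single, toBar_single, barMap_barS, ← map_zsmul]
    congr 1
    conv_lhs => rw [← sum_smul_single (P.d n (Pi.single i 1))]
    conv_rhs => rw [← sum_smul_single (Q.d n (Pi.single i 1))]
    rw [map_sum, map_sum, map_sum, Finset.smul_sum]
    refine Finset.sum_congr rfl fun j _ => ?_
    rw [map_smul, map_smulₛₗ, ih, map_smul, smul_comm, ← smul_assoc, F.map_d_single, smul_assoc]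

end Hom

/-! ### Both factors in terms of small resolutions -/

section Inflation

variable {G : Type} [Group G] {N : Subgroup G} [N.Normal] {P : BicyclicResolution G}
  {Q : BicyclicResolution (G ⧸ N)} {s : ℕ → ℤ} (F : Hom (QuotientGroup.mk' N) P Q s)

include F

/-- Inflation becomes a diagonal map on small cochains; this is what makes its image and kernel
computable. -/
theorem compare_inflCochain (n : ℕ) (c : Cochain n (G ⧸ N)) :
    P.compare n (inflCochain G N n c) = scale _ s (n + 1) (Q.compare n c) := by
  funext i
  refine (evalBar_barMap (A := Additive ℂˣ) (QuotientGroup.mk' N) c _).symm.trans ?_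
  rw [F.barMap_toBar, map_zsmul]
  rfl

/-- Computation of `H³(G, ℂˣ) / im p_3^*` from resolutions. -/
theorem nonempty_weakFactor_equiv {W : Type} [AddCommGroup W]
    (w : (P.δ (Additive ℂˣ) 3).ker →+ W) (hw : Function.Surjective w)
    (h : ∀ k, w k = 0 ↔ ∃ l b, Q.δ (Additive ℂˣ) 3 l = 0 ∧ k.1 = scale _ s 4 l + P.δ _ 2 b) :
    Nonempty (WeakFactor G N ≃+ W) := by
  have hm : ∀ z : (cobd 3 G).ker, P.compare 3 z.1 ∈ (P.δ (Additive ℂˣ) 3).ker := fun z => by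
    rw [AddMonoidHom.mem_ker, ← compare_cobd, z.2, map_zero]
  let r : (cobd 3 G).ker →+ (P.δ (Additive ℂˣ) 3).ker :=
    ((P.compare 3).comp (AddSubgroup.subtype _)).codRestrict _ hm
  refine nonempty_addEquiv_of_surjective (weakClass G N) (w.comp r)
    (weakClass_surjective G N) (fun y => ?_) (fun z => ?_)
  · obtain ⟨k, rfl⟩ := hw y
    obtain ⟨c, hc, l, hl⟩ := P.exists_compare 2 k.1 k.2
    refine ⟨⟨c, hc⟩, ?_⟩
    rw [AddMonoidHom.comp_apply, ← sub_eq_zero, ← map_sub, h]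
    refine ⟨0, l, map_zero _, ?_⟩
    change P.compare 3 c - k.1 = _
    rw [hl, map_zero]
    abel
  · rw [weakClass_eq_zero_iff, AddMonoidHom.comp_apply, h]
    constructor
    · rintro ⟨y, x, hz⟩
      refine ⟨Q.compare 3 y.1, P.compare 2 x, ?_, ?_⟩
      · rw [← compare_cobd, y.2, map_zero]
      · change P.compare 3 z.1 = _
        rw [hz, map_add, compare_inflCochain F, compare_cobd]
    · rintro ⟨l, b, hl, hz⟩
      have hz : P.compare 3 z.1 = _ := hz
      obtain ⟨y, hy, m, hm⟩ := Q.exists_compare 2 l hl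
      obtain ⟨x, hx⟩ := P.exists_cobd_of_compare 2 (z.1 - inflCochain G N 3 y)
        (by rw [map_sub, z.2, cobd_inflCochain, hy, map_zero, sub_zero])
        (b - scale _ s 3 m)
        (by rw [map_sub, hz, compare_inflCochain F, hm, map_sub, F.δ_scale, map_add]; abel)
      exact ⟨⟨y, hy⟩, x, by rw [hx]; exact (add_sub_cancel _ _).symm⟩

/-- Cocycles of the resolution of the quotient group with trivial inflation. -/
def inflKer (P : BicyclicResolution G) (Q : BicyclicResolution (G ⧸ N)) (s : ℕ → ℤ) :
    AddSubgroup (Fin 5 → Additive ℂˣ) :=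
  (Q.δ (Additive ℂˣ) 4).ker ⊓ (P.δ (Additive ℂˣ) 3).range.comap (scale _ s 5)

/-- Computation of `ker p_4^*` from resolutions. -/
theorem nonempty_anomalyFactor_equiv {E : Type} [AddCommGroup E]
    (w : inflKer P Q s →+ E) (hw : Function.Surjective w)
    (h : ∀ k, w k = 0 ↔ ∃ b, k.1 = Q.δ _ 3 b) :
    Nonempty (AnomalyFactor G N ≃+ E) := by
  -- Comparison detects coboundaries, so vanishing of the inflated class can be tested on the small
  -- resolution of `G`.
  have hinfl : ∀ z : (cobd 4 (G ⧸ N)).ker, infl G N 4 (cocycleClass (G ⧸ N) 4 z) = 0 ↔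
      scale _ s 5 (Q.compare 4 z.1) ∈ (P.δ (Additive ℂˣ) 3).range := fun z => by
    have hz : inflCochain G N 4 z.1 ∈ (cobd 4 G).ker := by
      rw [AddMonoidHom.mem_ker, cobd_inflCochain, z.2, map_zero]
    rw [infl_cocycleClass G N 4 z ⟨_, hz⟩ rfl, cocycleClass_eq_zero_iff, ← compare_inflCochain F]
    constructor
    · rintro ⟨x, hx⟩
      exact ⟨P.compare 3 x, by rw [← compare_cobd, hx]⟩
    · rintro ⟨k, hk⟩
      exact P.exists_cobd_of_compare 3 _ hz k hk.symm
  let S : AddSubgroup (cobd 4 (G ⧸ N)).ker := (infl G N 4).ker.comap (cocycleClass (G ⧸ N) 4)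
  let f : S →+ AnomalyFactor G N :=
    ((cocycleClass (G ⧸ N) 4).comp S.subtype).codRestrict _ fun z => z.2
  have hm : ∀ z : S, Q.compare 4 z.1.1 ∈ inflKer P Q s := fun z =>
    ⟨(Q.compare_cobd 4 z.1.1).symm.trans (by rw [z.1.2, map_zero]), (hinfl z.1).1 z.2⟩
  let r : S →+ inflKer P Q s :=
    ((Q.compare 4).comp ((AddSubgroup.subtype _).comp S.subtype)).codRestrict _ hm
  refine nonempty_addEquiv_of_surjective f (w.comp r) ?_ ?_ ?_
  · rintro ⟨c, hc⟩
    obtain ⟨z, rfl⟩ := cocycleClass_surjective _ _ c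
    exact ⟨⟨z, hc⟩, rfl⟩
  · intro y
    obtain ⟨k, rfl⟩ := hw y
    obtain ⟨c, hc, l, hl⟩ := Q.exists_compare 3 k.1 k.2.1
    obtain ⟨b, hb⟩ := k.2.2
    refine ⟨⟨⟨c, hc⟩, (hinfl _).2 ⟨b + scale _ s 4 l, ?_⟩⟩, ?_⟩
    · change _ = scale _ s 5 (Q.compare 4 c)
      rw [hl, map_add, map_add, F.δ_scale, hb]
    · rw [AddMonoidHom.comp_apply, ← sub_eq_zero, ← map_sub, h]
      refine ⟨l, ?_⟩
      change Q.compare 4 c - k.1 = _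
      rw [hl]
      abel
  · intro z
    rw [AddMonoidHom.comp_apply, h]
    refine Subtype.ext_iff.trans ?_
    change cocycleClass (G ⧸ N) 4 z.1 = 0 ↔ ∃ b, Q.compare 4 z.1.1 = _
    rw [cocycleClass_eq_zero_iff]
    constructor
    · rintro ⟨x, hx⟩
      exact ⟨Q.compare 3 x, by rw [← compare_cobd, hx]⟩
    · rintro ⟨k, hk⟩
      exact Q.exists_cobd_of_compare 3 _ z.1.2 k hk

end Inflation

end BicyclicResolution

/-! ### Small resolutions for split extensions of cyclic groups -/

/-- An extension of `ℤ/m` by the cyclic group of order `n` generated by `x`, split by `y`. -/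
structure CyclicExtension (G : Type) [Group G] (n m : ℕ) where
  x : G
  y : G
  β : G →* Multiplicative (ZMod m)
  n_pos : 0 < n
  m_pos : 0 < m
  orderOf_x : orderOf x = n
  y_pow : y ^ m = 1
  β_x : β x = 1
  β_y : β y = Multiplicative.ofAdd 1
  mem_zpowers : ∀ g, β g = 1 → g ∈ Subgroup.zpowers x

namespace CyclicExtension

variable {G : Type} [Group G] {n m : ℕ} (E : CyclicExtension G n m)

/-- The section of `β`. -/
def lift (b : Multiplicative (ZMod m)) : G := E.y ^ (b.toAdd).val

theorem β_lift (b : Multiplicative (ZMod m)) : E.β (E.lift b) = b := by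
  have : NeZero m := ⟨E.m_pos.ne'⟩
  rw [lift, map_pow, E.β_y, ← ofAdd_nsmul]
  simp

theorem eq_lift_mul_pow (g : G) : ∃ k < n, g = E.lift (E.β g) * E.x ^ k := by
  classical
  have h := E.mem_zpowers ((E.lift (E.β g))⁻¹ * g) (by
    rw [map_mul, map_inv, β_lift, inv_mul_cancel])
  have hx : IsOfFinOrder E.x := by rw [← orderOf_pos_iff, E.orderOf_x]; exact E.n_pos
  rw [hx.mem_zpowers_iff_mem_range_orderOf, Finset.mem_image] at h
  obtain ⟨k, hk, h⟩ := h
  rw [Finset.mem_range, E.orderOf_x] at hk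
  exact ⟨k, hk, by rw [h, mul_inv_cancel_left]⟩

/-- The generator `x` in the group ring. -/
def X : MonoidAlgebra ℤ G := of ℤ G E.x

/-- The generator `y` in the group ring. -/
def Y : MonoidAlgebra ℤ G := of ℤ G E.y

/-- The norm element of `⟨x⟩`. -/
def normX : MonoidAlgebra ℤ G := ∑ k ∈ Finset.range n, E.X ^ k

theorem X_pow (k : ℕ) : E.X ^ k = of ℤ G (E.x ^ k) := (map_pow _ _ _).symm

theorem X_pow_n : E.X ^ n = 1 := by
  have h := pow_orderOf_eq_one E.x
  rw [E.orderOf_x] at h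
  rw [X_pow, h, map_one]

theorem Y_pow_m : E.Y ^ m = 1 := by rw [Y, ← map_pow, E.y_pow, map_one]

theorem normX_mul : E.normX * (E.X - 1) = 0 := by
  rw [normX, geom_sum_mul, X_pow_n, sub_self]

theorem mul_normX : (E.X - 1) * E.normX = 0 := by
  rw [normX, mul_geom_sum, X_pow_n, sub_self]

theorem ringMap_X : ringMap E.β E.X = 1 := by rw [X, ringMap_of, E.β_x, map_one]

theorem aug_X : aug G E.X = 1 := aug_of _ _

theorem aug_Y : aug G E.Y = 1 := aug_of _ _

/-- Every `g` is `y ^ b * x ^ k`, and `x ^ k - 1` is a multiple of `x - 1`; hence modulo the left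
ideal of `x - 1` only the image under `β` matters. -/
theorem exists_sub_mapDomain (r : MonoidAlgebra ℤ G) :
    ∃ t, r - MonoidAlgebra.mapDomain E.lift (ringMap E.β r) = t * (E.X - 1) := by
  induction r using MonoidAlgebra.induction_linear with
  | zero => exact ⟨0, by simp⟩
  | add r r' h h' =>
    obtain ⟨t, h⟩ := h
    obtain ⟨t', h'⟩ := h'
    exact ⟨t + t', by rw [add_mul, ← h, ← h', map_add, MonoidAlgebra.mapDomain_add]; abel⟩
  | single g a =>
    obtain ⟨k, -, hk⟩ := E.eq_lift_mul_pow g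
    refine ⟨single (E.lift (E.β g)) a * ∑ i ∈ Finset.range k, E.X ^ i, ?_⟩
    rw [mul_assoc, geom_sum_mul, X_pow, mul_sub, mul_one, MonoidAlgebra.of_apply,
      MonoidAlgebra.single_mul_single, ← hk, mul_one]
    simp

theorem exists_of_ringMap_eq_zero (r : MonoidAlgebra ℤ G) (hr : ringMap E.β r = 0) :
    ∃ t, r = t * (E.X - 1) := by
  obtain ⟨t, ht⟩ := E.exists_sub_mapDomain r
  rw [hr, MonoidAlgebra.mapDomain_zero, sub_zero] at ht
  exact ⟨t, ht⟩

/-- Under `β` the norm becomes the integer `n`, and `ℤ[ℤ/m]` is torsion-free, so `r` maps to zero.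
-/
theorem exists_of_mul_normX (r : MonoidAlgebra ℤ G) (hr : r * E.normX = 0) :
    ∃ t, r = t * (E.X - 1) := by
  refine E.exists_of_ringMap_eq_zero r ?_
  have h := congrArg (ringMap E.β) hr
  rw [map_mul, normX, map_sum] at h
  simp only [map_pow, ringMap_X, one_pow, map_zero, Finset.sum_const, Finset.card_range,
    nsmul_eq_mul, mul_one] at h
  rw [← Nat.cast_comm, ← nsmul_eq_mul] at h
  refine MonoidAlgebra.ext (Finsupp.ext fun b => ?_)
  have h' := congrArg (fun z => z.coeff b) h
  have h' : n • (ringMap E.β r).coeff b = 0 := h'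
  exact (smul_eq_zero.1 h').resolve_left E.n_pos.ne'

/-- The coefficients of `r` are constant on the cosets `g⟨x⟩`; `t` keeps those at the
representatives `y ^ b`. -/
theorem exists_of_mul_X_sub_one (r : MonoidAlgebra ℤ G) (hr : r * (E.X - 1) = 0) :
    ∃ t, r = t * E.normX := by
  classical
  have hX : ∀ k : ℕ, r * E.X ^ k = r := fun k => by
    induction k with
    | zero => simp
    | succ k ih =>
      rw [mul_sub, mul_one, sub_eq_zero] at hr
      rw [pow_succ', ← mul_assoc, hr, ih]
  have hcoeff : ∀ (r : MonoidAlgebra ℤ G) (g : G) (k : ℕ),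
      (r * E.X ^ k).coeff g = r.coeff (g * (E.x ^ k)⁻¹) := fun r g k => by
    rw [X_pow, MonoidAlgebra.of_apply, MonoidAlgebra.coeff_mul_single_apply, mul_one]
  refine ⟨.ofCoeff (r.coeff.filter fun g => g = E.lift (E.β g)),
    MonoidAlgebra.ext (Finsupp.ext fun g => ?_)⟩
  obtain ⟨k, hk, hg⟩ := E.eq_lift_mul_pow g
  have hβ : ∀ j : ℕ, E.β (g * (E.x ^ j)⁻¹) = E.β g := fun j => by simp [E.β_x]
  rw [normX, Finset.mul_sum, MonoidAlgebra.coeff_sum, Finsupp.finsetSum_apply,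
    Finset.sum_eq_single k]
  · rw [hcoeff, MonoidAlgebra.coeff_ofCoeff, Finsupp.filter_apply_pos, ← hcoeff, hX]
    rw [hβ, mul_inv_eq_iff_eq_mul]
    exact hg
  · intro j hj hjk
    rw [hcoeff, MonoidAlgebra.coeff_ofCoeff, Finsupp.filter_apply_neg]
    rw [hβ, mul_inv_eq_iff_eq_mul]
    intro hj'
    refine hjk (pow_injOn_Iio_orderOf (x := E.x) ?_ ?_ (mul_left_cancel (hj'.symm.trans hg)))
    · rw [E.orderOf_x]; exact Finset.mem_range.1 hj
    · rw [E.orderOf_x]; exact hk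
  · intro h
    exact absurd (Finset.mem_range.2 hk) h

theorem exists_of_aug (r : MonoidAlgebra ℤ G) (hr : aug G r = 0) :
    ∃ s s', r = s * (E.Y - 1) + s' * (E.X - 1) := by
  suffices h : ∀ r : MonoidAlgebra ℤ G,
      ∃ s s', r - single 1 (aug G r) = s * (E.Y - 1) + s' * (E.X - 1) by
    obtain ⟨s, s', h⟩ := h r
    exact ⟨s, s', by simpa [hr] using h⟩
  clear hr r
  intro r
  induction r using MonoidAlgebra.induction_linear with
  | zero => exact ⟨0, 0, by simp⟩
  | add r r' h h' =>
    obtain ⟨s, s', h⟩ := h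
    obtain ⟨t, t', h'⟩ := h'
    refine ⟨s + t, s' + t', ?_⟩
    rw [map_add, MonoidAlgebra.single_add, add_mul, add_mul, add_add_add_comm, ← h, ← h']
    abel
  | single g a =>
    obtain ⟨k, -, hk⟩ := E.eq_lift_mul_pow g
    refine ⟨single 1 a * ∑ i ∈ Finset.range (E.β g).toAdd.val, E.Y ^ i,
      single (E.lift (E.β g)) a * ∑ i ∈ Finset.range k, E.X ^ i, ?_⟩
    rw [mul_assoc, mul_assoc, geom_sum_mul, geom_sum_mul, X_pow, Y, ← map_pow]
    change _ = _ * (of ℤ G (E.lift (E.β g)) - 1) + _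
    rw [mul_sub, mul_sub, mul_one, mul_one, MonoidAlgebra.of_apply, MonoidAlgebra.of_apply,
      MonoidAlgebra.single_mul_single, MonoidAlgebra.single_mul_single, ← hk]
    simp [aug]

/-- The cyclic group as an extension of the trivial group. -/
def cyclic (m : ℕ) (hm : 0 < m) : CyclicExtension (Multiplicative (ZMod m)) m 1 where
  x := Multiplicative.ofAdd 1
  y := 1
  β := 1
  n_pos := hm
  m_pos := one_pos
  orderOf_x := by rw [orderOf_ofAdd_eq_addOrderOf, ZMod.addOrderOf_one]
  y_pow := one_pow _
  β_x := rfl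
  β_y := Subsingleton.elim _ _
  mem_zpowers g _ := by
    have : NeZero m := ⟨hm.ne'⟩
    refine ⟨(g.toAdd.val : ℤ), ?_⟩
    change Multiplicative.ofAdd (1 : ZMod m) ^ (g.toAdd.val : ℤ) = g
    rw [zpow_natCast, ← ofAdd_nsmul, nsmul_one, ZMod.natCast_zmod_val, ofAdd_toAdd]

/-- Modulo `X - 1` this is exactness of the periodic resolution of `ℤ/m`, obtained by viewing `ℤ/m`
itself as an extension of the trivial group. The quotient found there is lifted along the section of
`β`. -/
theorem exists_of_mul_Y_sub_one (r t : MonoidAlgebra ℤ G) (hr : r * (E.Y - 1) = t * (E.X - 1)) :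
    ∃ s s', r = s * (∑ k ∈ Finset.range m, E.Y ^ k) + s' * (E.X - 1) := by
  have hY : ringMap E.β E.Y = (cyclic m E.m_pos).X := by rw [Y, ringMap_of, E.β_y]; rfl
  obtain ⟨u, hu⟩ := (cyclic m E.m_pos).exists_of_mul_X_sub_one (ringMap E.β r) (by
    rw [← hY, ← map_one (ringMap E.β), ← map_sub, ← map_mul, hr, map_mul, map_sub, ringMap_X,
      map_one, sub_self, mul_zero])
  have hσ : ∀ u, ringMap E.β (MonoidAlgebra.mapDomain E.lift u) = u := fun u => by
    induction u using MonoidAlgebra.induction_linear with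
    | zero => simp
    | add u u' h h' => rw [MonoidAlgebra.mapDomain_add, map_add, h, h']
    | single b a => simp [β_lift]
  obtain ⟨s', hs'⟩ := E.exists_of_ringMap_eq_zero
    (r - MonoidAlgebra.mapDomain E.lift u * ∑ k ∈ Finset.range m, E.Y ^ k) (by
      rw [map_sub, map_mul, hσ, hu, map_sum]
      simp only [map_pow, hY]
      exact sub_self _)
  exact ⟨_, s', by rw [← hs', add_sub_cancel]⟩

/-- Lifts of conjugation by `y` to the resolution of `⟨x⟩`. -/
structure Twist where
  u : ℕ → MonoidAlgebra ℤ G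
  u_zero : u 0 = E.Y
  u_pow : ∀ i, u i ^ m = 1
  semiconj_even : ∀ i, Even i → SemiconjBy (E.X - 1) (u i) (u (i + 1))
  semiconj_odd : ∀ i, ¬ Even i → SemiconjBy E.normX (u i) (u (i + 1))

variable {E}

/-- The resolution attached to a split extension of cyclic groups. -/
def Twist.resolution (T : E.Twist) : BicyclicResolution G where
  ξ i := if Even i then E.X - 1 else E.normX
  η i j := if Even j then T.u i - 1 else ∑ k ∈ Finset.range m, T.u i ^ k
  ξ_mul_ξ i := by
    by_cases h : Even i
    · simp [h, Nat.even_add_one, normX_mul]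
    · simp [h, Nat.even_add_one, mul_normX]
  η_mul_η i j := by
    by_cases h : Even j
    · simp [h, Nat.even_add_one, geom_sum_mul, T.u_pow]
    · simp [h, Nat.even_add_one, mul_geom_sum, T.u_pow]
  ξ_mul_η i j := by
    have h1 : SemiconjBy (if Even i then E.X - 1 else E.normX) (T.u i) (T.u (i + 1)) := by
      split_ifs with h
      exacts [T.semiconj_even i h, T.semiconj_odd i h]
    generalize (if Even i then E.X - 1 else E.normX) = z at h1
    change SemiconjBy z _ _
    split_ifs with h
    · exact h1.sub_right (SemiconjBy.one_right z)
    · simp only [SemiconjBy, Finset.mul_sum, Finset.sum_mul]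
      exact Finset.sum_congr rfl fun k _ => h1.pow_right k
  aug_ξ_zero := by simp [aug_X]
  aug_η_zero := by simp [T.u_zero, aug_Y]
  exact_ξ i r h := by
    by_cases hi : Even i
    · simp only [hi, Nat.even_add_one, if_true, not_true_eq_false, if_false] at h ⊢
      exact E.exists_of_mul_X_sub_one r h
    · simp only [hi, Nat.even_add_one, if_true, not_false_eq_true, if_false] at h ⊢
      exact E.exists_of_mul_normX r h
  exact_η j r t h := by
    by_cases hj : Even j
    · simp only [hj, Nat.even_add_one, if_true, not_true_eq_false, if_false, T.u_zero,
        Even.zero] at h ⊢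
      exact E.exists_of_mul_Y_sub_one r t h
    · simp only [hj, Nat.even_add_one, if_true, not_false_eq_true, if_false, T.u_zero,
        Even.zero] at h ⊢
      refine E.exists_of_aug r ?_
      have h' := congrArg (aug G) h
      simpa [aug_X, aug_Y, E.m_pos.ne'] using h'
  exact_aug r h := by
    simp only [Even.zero, if_true, T.u_zero]
    exact E.exists_of_aug r h

variable (E)

/-- The trivial twist, for a commutative extension. -/
def commTwist (h : Commute E.x E.y) : E.Twist where
  u _ := E.Y
  u_zero := rfl
  u_pow _ := E.Y_pow_m
  semiconj_even _ _ := (Commute.map h (of ℤ G)).sub_left (Commute.one_left _)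
  semiconj_odd _ _ := Commute.sum_left _ _ _ fun k _ => (Commute.map h (of ℤ G)).pow_left k

end CyclicExtension

/-! ### The twist when `y` inverts `x` -/

namespace CyclicExtension

variable {G : Type} [Group G] {n : ℕ} (E : CyclicExtension G n 2)

/-- The twist of a dihedral group. -/
def dihedralTwist (h : E.x * E.y * E.x = E.y) : E.Twist where
  u i := if i % 4 = 0 then E.Y else if i % 4 = 1 then -(E.X * E.Y) else
    if i % 4 = 2 then -E.Y else E.X * E.Y
  u_zero := rfl
  u_pow i := by
    have h1 : E.X * E.Y * E.X = E.Y := by simp only [X, Y, ← map_mul, h]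
    have h2 : E.Y * E.Y = 1 := by rw [← pow_two, E.Y_pow_m]
    have h3 : E.X * E.Y * (E.X * E.Y) = 1 := by rw [← mul_assoc, h1, h2]
    split_ifs <;> simp [pow_two, h2, h3]
  semiconj_even i hi := by
    have h1 : E.X * E.Y * E.X = E.Y := by simp only [X, Y, ← map_mul, h]
    obtain ⟨k, rfl⟩ := hi
    rcases Nat.even_or_odd k with ⟨l, rfl⟩ | ⟨l, rfl⟩
    · have e1 : (l + l + (l + l)) % 4 = 0 := by omega
      have e2 : (l + l + (l + l) + 1) % 4 = 1 := by omega
      simp [e1, e2, SemiconjBy, sub_mul, mul_sub, h1]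
      abel
    · have e1 : (2 * l + 1 + (2 * l + 1)) % 4 = 2 := by omega
      have e2 : (2 * l + 1 + (2 * l + 1) + 1) % 4 = 3 := by omega
      simp [e1, e2, SemiconjBy, sub_mul, mul_sub, h1]
  semiconj_odd i hi := by
    have h1 : E.X * E.Y * E.X = E.Y := by simp only [X, Y, ← map_mul, h]
    have hN : E.normX * E.X = E.normX := by
      have := E.normX_mul
      rwa [mul_sub, mul_one, sub_eq_zero] at this
    have h2 : ∀ k : ℕ, E.X ^ k * E.Y * E.X ^ k = E.Y := fun k => by
      induction k with
      | zero => simp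
      | succ k ih =>
        calc E.X ^ (k + 1) * E.Y * E.X ^ (k + 1) = E.X ^ k * (E.X * E.Y * E.X) * E.X ^ k := by
              rw [pow_succ, mul_assoc _ E.X E.Y, mul_assoc, ← pow_succ, pow_succ']
              simp only [mul_assoc]
          _ = E.Y := by rw [h1, ih]
    -- Termwise this is `X ^ k * Y = Y * X ^ (n - k)`. Reversing the order of summation gives
    -- exponents `n - 1 - k`, and the missing factor `X` is absorbed by the norm.
    have h3 : E.normX * E.Y = E.Y * E.normX := by
      conv_rhs => rw [← hN, normX, ← Finset.sum_range_reflect, Finset.sum_mul, Finset.mul_sum]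
      rw [normX, Finset.sum_mul]
      refine Finset.sum_congr rfl fun k hk => ?_
      have hk := Finset.mem_range.1 hk
      conv_rhs => rw [← h2 k]
      rw [← pow_succ, mul_assoc, ← pow_add, show k + (n - 1 - k + 1) = n by omega, X_pow_n, mul_one]
    rw [Nat.not_even_iff_odd] at hi
    obtain ⟨k, rfl⟩ := hi
    rcases Nat.even_or_odd k with ⟨l, rfl⟩ | ⟨l, rfl⟩
    · have e1 : (2 * (l + l) + 1) % 4 = 1 := by omega
      have e2 : (2 * (l + l) + 1 + 1) % 4 = 2 := by omega
      simp [e1, e2, SemiconjBy, ← mul_assoc, hN, h3]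
    · have e1 : (2 * (2 * l + 1) + 1) % 4 = 3 := by omega
      have e2 : (2 * (2 * l + 1) + 1 + 1) % 4 = 0 := by omega
      simp [e1, e2, SemiconjBy, ← mul_assoc, hN, h3]

end CyclicExtension

/-! ### Passage to the quotient by `⟨x ^ q⟩` -/

namespace CyclicExtension

variable {G : Type} [Group G] {n m : ℕ} (E : CyclicExtension G n m)

/-- The extension induced on the quotient by `⟨x ^ q⟩`. -/
def quotient (p q : ℕ) (hn : n = p * q) (N : Subgroup G) [N.Normal]
    (hN : N = Subgroup.zpowers (E.x ^ q)) : CyclicExtension (G ⧸ N) q m where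
  x := QuotientGroup.mk' N E.x
  y := QuotientGroup.mk' N E.y
  β := QuotientGroup.lift N E.β (by
    rw [hN]
    rintro _ ⟨k, rfl⟩
    simp [E.β_x])
  n_pos := Nat.pos_of_mul_pos_left (hn ▸ E.n_pos)
  m_pos := E.m_pos
  orderOf_x := by
    refine Nat.dvd_antisymm ?_ ?_
    · rw [orderOf_dvd_iff_pow_eq_one, ← map_pow, QuotientGroup.mk'_apply,
        QuotientGroup.eq_one_iff, hN]
      exact Subgroup.mem_zpowers _
    · have h : (QuotientGroup.mk' N E.x) ^ orderOf (QuotientGroup.mk' N E.x) = 1 :=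
        pow_orderOf_eq_one _
      rw [← map_pow, QuotientGroup.mk'_apply, QuotientGroup.eq_one_iff] at h
      obtain ⟨k, hk⟩ := hN.le h
      have hk : (E.x ^ q) ^ k = E.x ^ orderOf (QuotientGroup.mk' N E.x) := hk
      rw [← zpow_natCast, ← zpow_natCast, ← zpow_mul, zpow_eq_zpow_iff_modEq, E.orderOf_x] at hk
      have := (Int.ModEq.of_dvd ⟨(p : ℤ), by rw [hn, Nat.cast_mul, mul_comm]⟩ hk :
        _ ≡ _ [ZMOD q]).dvd
      rw [dvd_sub_left (dvd_mul_right _ _)] at this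
      exact_mod_cast this
  y_pow := by rw [← map_pow, E.y_pow, map_one]
  β_x := E.β_x
  β_y := E.β_y
  mem_zpowers g hg := by
    induction g using QuotientGroup.induction_on with | H g => ?_
    obtain ⟨k, hk⟩ := E.mem_zpowers g hg
    exact ⟨k, by rw [← hk]; rfl⟩

theorem sum_range_mul_pow {R : Type*} [Semiring R] (z : R) (p q : ℕ) (hz : z ^ q = 1) :
    ∑ k ∈ Finset.range (p * q), z ^ k = p • ∑ k ∈ Finset.range q, z ^ k := by
  induction p with
  | zero => simp
  | succ p ih =>
    rw [Nat.succ_mul, Finset.sum_range_add, ih, succ_nsmul]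
    simp only [pow_add, mul_comm p q, pow_mul, hz, one_pow, one_mul]

/-- The map of resolutions over the quotient map. -/
theorem quotient_hom (p q : ℕ) (hn : n = p * q) (N : Subgroup G) [N.Normal]
    (hN : N = Subgroup.zpowers (E.x ^ q)) (T : E.Twist) (T' : (E.quotient p q hn N hN).Twist)
    (hT : ∀ i, ringMap (QuotientGroup.mk' N) (T.u i) = T'.u i) :
    BicyclicResolution.Hom (QuotientGroup.mk' N) T.resolution T'.resolution
      fun i => (p : ℤ) ^ (i / 2) where
  s_zero := rfl
  map_ξ i := by
    have hX : ringMap (QuotientGroup.mk' N) E.X = (E.quotient p q hn N hN).X := ringMap_of _ _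
    -- Each power of the image of `x` is hit `p` times. Norms occur at odd `i` only, so a factor `p`
    -- is gained every second step, giving `p ^ (i / 2)`.
    have hnorm : ringMap (QuotientGroup.mk' N) E.normX =
        p • (E.quotient p q hn N hN).normX := by
      rw [normX, map_sum, normX, ← sum_range_mul_pow _ p q (X_pow_n _), ← hn]
      simp only [map_pow, hX]
    by_cases hi : Even i
    · obtain ⟨k, rfl⟩ := hi
      have e1 : (k + k) / 2 = k := by omega
      have e2 : (k + k + 1) / 2 = k := by omega
      simp only [Twist.resolution, e1, e2, Even.add_self, if_true, map_sub, hX, map_one]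
    · obtain ⟨k, rfl⟩ := Nat.not_even_iff_odd.1 hi
      have e1 : (2 * k + 1) / 2 = k := by omega
      have e2 : (2 * k + 1 + 1) / 2 = k + 1 := by omega
      simp only [Twist.resolution, hi, if_false, e1, e2, hnorm]
      rw [pow_succ, mul_smul, natCast_zsmul]
  map_η i j := by
    simp only [Twist.resolution]
    split_ifs
    · rw [map_sub, hT, map_one]
    · rw [map_sum]
      simp only [map_pow, hT]

variable {E}

theorem Twist.aug_ξ (T : E.Twist) (i : ℕ) :
    aug G (T.resolution.ξ i) = if Even i then 0 else (n : ℤ) := by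
  simp only [Twist.resolution]
  split_ifs <;> simp [normX, aug_X]

theorem Twist.aug_η (T : E.Twist) (i j : ℕ) :
    aug G (T.resolution.η i j) = if Even j then aug G (T.u i) - 1 else
      ∑ k ∈ Finset.range m, aug G (T.u i) ^ k := by
  simp only [Twist.resolution]
  split_ifs <;> simp

end CyclicExtension

/-! ### Coboundaries of the small complex in low degrees -/

namespace BicyclicResolution

variable {G : Type} [Group G] (P : BicyclicResolution G) {A : Type*} [AddCommGroup A]

theorem δ_apply (n : ℕ) (k : Fin (n + 1) → A) (i : Fin (n + 2)) :
    P.δ A n k i = ∑ j : Fin (n + 1), ((if (j:ℕ)+1 = i then aug G (P.ξ j) else 0) +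
      (-1) ^ (j : ℕ) * (if (j:ℕ) = i then aug G (P.η j (n - j)) else 0)) • k j := by
  change ∑ j : Fin (n + 1), aug G (P.d n (Pi.single i 1) j) • k j = _
  refine Finset.sum_congr rfl fun j _ => ?_
  rw [d_apply, Pi.single_apply, Pi.single_apply]
  congr 1
  simp only [Fin.ext_iff, Fin.val_succ, Fin.val_castSucc]
  split_ifs <;> simp

/-- In degree `n`, coordinate `i` is the value on the generator of bidegree `(i, n - i)`. -/
theorem δ_two (k : Fin 3 → A) : P.δ A 2 k = ![aug G (P.η 0 2) • k 0,
    aug G (P.ξ 0) • k 0 - aug G (P.η 1 1) • k 1,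
    aug G (P.ξ 1) • k 1 + aug G (P.η 2 0) • k 2, aug G (P.ξ 2) • k 2] := by
  funext i
  rw [δ_apply, Fin.sum_univ_three]
  fin_cases i <;> simp [sub_eq_add_neg]

theorem δ_three (k : Fin 4 → A) : P.δ A 3 k = ![aug G (P.η 0 3) • k 0,
    aug G (P.ξ 0) • k 0 - aug G (P.η 1 2) • k 1,
    aug G (P.ξ 1) • k 1 + aug G (P.η 2 1) • k 2,
    aug G (P.ξ 2) • k 2 - aug G (P.η 3 0) • k 3, aug G (P.ξ 3) • k 3] := by
  funext i
  rw [δ_apply, Fin.sum_univ_four]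
  fin_cases i <;> simp [sub_eq_add_neg]

theorem δ_four (k : Fin 5 → A) : P.δ A 4 k = ![aug G (P.η 0 4) • k 0,
    aug G (P.ξ 0) • k 0 - aug G (P.η 1 3) • k 1,
    aug G (P.ξ 1) • k 1 + aug G (P.η 2 2) • k 2,
    aug G (P.ξ 2) • k 2 - aug G (P.η 3 1) • k 3,
    aug G (P.ξ 3) • k 3 + aug G (P.η 4 0) • k 4, aug G (P.ξ 4) • k 4] := by
  funext i
  rw [δ_apply, Fin.sum_univ_five]
  fin_cases i <;> simp [sub_eq_add_neg]

end BicyclicResolution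

/-! ### Torsion and divisibility of `ℂˣ` -/

section Torsion

theorem exists_nsmul_eq {n : ℕ} (hn : 0 < n) (a : Additive ℂˣ) : ∃ b, n • b = a := by
  obtain ⟨z, hz⟩ := IsAlgClosed.exists_pow_nat_eq (a.toMul : ℂ) hn
  have h0 : z ≠ 0 := fun h => by
    rw [h, zero_pow hn.ne'] at hz
    exact a.toMul.ne_zero hz.symm
  exact ⟨Additive.ofMul (Units.mk0 z h0), Units.ext hz⟩

/-- The `n`-torsion of an abelian group. -/
abbrev torsion (A : Type*) [AddCommGroup A] (n : ℕ) : AddSubgroup A :=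
  (nsmulAddMonoidHom n : A →+ A).ker

theorem nonempty_torsion_equiv {n : ℕ} (hn : 0 < n) :
    Nonempty (torsion (Additive ℂˣ) n ≃+ ZMod n) := by
  have : NeZero n := ⟨hn.ne'⟩
  have e : rootsOfUnity n ℂ ≃* Multiplicative (torsion (Additive ℂˣ) n) :=
    { toFun := fun z => Multiplicative.ofAdd ⟨Additive.ofMul z.1, z.2⟩
      invFun := fun a => ⟨(a.toAdd.1).toMul, a.toAdd.2⟩
      left_inv := fun _ => rfl
      right_inv := fun _ => rfl
      map_mul' := fun _ _ => rfl }
  have hc : IsCyclic (Multiplicative (torsion (Additive ℂˣ) n)) :=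
    isCyclic_of_surjective e e.surjective
  have hcard : Nat.card (torsion (Additive ℂˣ) n) = n := by
    have h := Nat.card_congr e.toEquiv
    rw [Complex.card_rootsOfUnity] at h
    exact h.symm
  have h := zmodAddCyclicAddEquiv (G := torsion (Additive ℂˣ) n) (isCyclic_multiplicative_iff.1 hc)
  rw [hcard] at h
  exact ⟨h.symm⟩

/-- With `a' * s + b' * t = 1`, divisibility provides `l` with `g • l = s • u + t • v`, and the
compatibility `b' • u = a' • v` turns this into both equations. -/
theorem exists_common_quotient {A : Type*} [AddCommGroup A]
    (hA : ∀ n : ℕ, 0 < n → ∀ a : A, ∃ b, n • b = a) {a b g a' b' : ℕ} (hg : 0 < g)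
    (ha : a = g * a') (hb : b = g * b') (hab : Nat.Coprime a' b') (u v : A)
    (h : b' • u = a' • v) : ∃ l, a • l = u ∧ b • l = v := by
  obtain ⟨s, t, hst⟩ : ∃ s t : ℤ, a' * s + b' * t = 1 :=
    ⟨_, _, by rw [← Nat.gcd_eq_gcd_ab, hab.gcd_eq_one, Nat.cast_one]⟩
  have h : (b' : ℤ) • u = (a' : ℤ) • v := by simpa using h
  obtain ⟨l, hl⟩ := hA g hg (s • u + t • v)
  refine ⟨l, ?_, ?_⟩
  · rw [ha, mul_comm, mul_smul, hl, ← natCast_zsmul, smul_add, smul_comm _ t, ← h, smul_smul,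
      smul_smul, ← add_smul, mul_comm t, hst, one_smul]
  · rw [hb, mul_comm, mul_smul, hl, ← natCast_zsmul, smul_add, smul_comm _ s, h, smul_smul,
      smul_smul, ← add_smul, mul_comm s, hst, one_smul]

end Torsion

namespace BicyclicResolution

/-! ### Linear algebra of the two factors over a divisible group -/

section Cochains

variable {G H : Type} [Group G] [Group H] {P : BicyclicResolution G} {Q : BicyclicResolution H}
  {A : Type*} [AddCommGroup A] (hA : ∀ n : ℕ, 0 < n → ∀ a : A, ∃ b, n • b = a) {p q m : ℕ}

theorem scale_four (k : Fin 4 → A) :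
    scale A (fun i => (p : ℤ) ^ (i / 2)) 4 k = ![k 0, k 1, p • k 2, p • k 3] := by
  funext i
  fin_cases i <;> simp

theorem scale_five (k : Fin 5 → A) :
    scale A (fun i => (p : ℤ) ^ (i / 2)) 5 k = ![k 0, k 1, p • k 2, p • k 3, p • p • k 4] := by
  funext i
  fin_cases i <;> simp [pow_two, mul_smul]

/-- A linear form that is `e`-torsion on `S`, as a homomorphism to the `e`-torsion. -/
def coordHom {n : ℕ} (S : AddSubgroup (Fin n → A)) (f : (Fin n → A) →+ A) (e : ℕ)
    (h : ∀ k ∈ S, e • f k = 0) : S →+ torsion A e :=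
  (f.comp S.subtype).codRestrict _ fun k => h k.1 k.2

theorem coordHom_eq_zero {n : ℕ} {S : AddSubgroup (Fin n → A)} {f : (Fin n → A) →+ A} {e : ℕ}
    {h : ∀ k ∈ S, e • f k = 0} (k : S) : coordHom S f e h k = 0 ↔ f k.1 = 0 := Subtype.ext_iff

include hA

/-- Coordinate 0 is always inflated. Coordinate 3 is inflated iff some `l` has `p • l = k 3` and `q
• l = 0`, that is, iff `q₁ • k 3 = 0` with `q₁ = q / gcd p q`. Given `k 1`, coordinate 2 needs `l`
with `p • l = k 2` and `m • l = -(q • k 1)`; the obstruction is `p₂ • q • k 1 + m₂ • k 2`, where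
`p₂`, `m₂` are `p`, `m` divided by their gcd. -/
theorem exists_weak_comm (hp : 0 < p) (hq : 0 < q) (hm : 0 < m)
    (hP₂ : ∀ k, P.δ A 2 k = ![0, -(m • k 1), (p * q) • k 1, 0])
    (hP₃ : ∀ k, P.δ A 3 k = ![m • k 0, 0, (p * q) • k 1 + m • k 2, 0, (p * q) • k 3])
    (hQ₃ : ∀ k, Q.δ A 3 k = ![m • k 0, 0, q • k 1 + m • k 2, 0, q • k 3]) :
    ∃ w : (P.δ A 3).ker →+ torsion A (p * Nat.gcd p q) × torsion A (Nat.gcd p m),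
      Function.Surjective w ∧ ∀ k, w k = 0 ↔ ∃ l b, Q.δ A 3 l = 0 ∧
        k.1 = scale A (fun i => (p : ℤ) ^ (i / 2)) 4 l + P.δ A 2 b := by
  obtain ⟨g, hg⟩ : ∃ g, g = Nat.gcd p q := ⟨_, rfl⟩
  obtain ⟨e, he⟩ : ∃ e, e = Nat.gcd p m := ⟨_, rfl⟩
  have hg0 : 0 < g := hg ▸ Nat.gcd_pos_of_pos_left _ hp
  have he0 : 0 < e := he ▸ Nat.gcd_pos_of_pos_left _ hp
  obtain ⟨p₁, q₁, hc₁, hp₁, hq₁⟩ := Nat.exists_coprime p q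
  obtain ⟨p₂, m₂, hc₂, hp₂, hm₂⟩ := Nat.exists_coprime p m
  rw [← hg, mul_comm] at hp₁ hq₁
  rw [← he, mul_comm] at hp₂ hm₂
  rw [← hg, ← he]
  have hZ : ∀ k ∈ (P.δ A 3).ker,
      m • k 0 = 0 ∧ (p * q) • k 1 + m • k 2 = 0 ∧ (p * q) • k 3 = 0 := fun k hk => by
    rw [AddMonoidHom.mem_ker, hP₃] at hk
    exact ⟨congrFun hk 0, congrFun hk 2, congrFun hk 4⟩
  let f₁ : (Fin 4 → A) →+ A := (nsmulAddMonoidHom q₁).comp (Pi.evalAddMonoidHom _ 3)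
  let f₂ : (Fin 4 → A) →+ A := (nsmulAddMonoidHom (p₂ * q)).comp (Pi.evalAddMonoidHom _ 1) +
    (nsmulAddMonoidHom m₂).comp (Pi.evalAddMonoidHom _ 2)
  have h₁ : ∀ k ∈ (P.δ A 3).ker, (p * g) • f₁ k = 0 := fun k hk => by
    change (p * g) • q₁ • k 3 = 0
    rw [← mul_smul, mul_assoc, ← hq₁, (hZ k hk).2.2]
  have h₂ : ∀ k ∈ (P.δ A 3).ker, e • f₂ k = 0 := fun k hk => by
    change e • ((p₂ * q) • k 1 + m₂ • k 2) = 0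
    rw [smul_add, ← mul_smul, ← mul_smul, ← mul_assoc, ← hp₂, ← hm₂, (hZ k hk).2.1]
  refine ⟨(coordHom _ f₁ _ h₁).prod (coordHom _ f₂ _ h₂), ?_, fun k => ?_⟩
  · rintro ⟨⟨y, hy⟩, ⟨z, hz⟩⟩
    have hy : (p * g) • y = 0 := hy
    have hz : e • z = 0 := hz
    obtain ⟨y', hy'⟩ := hA q₁ (Nat.pos_of_mul_pos_left (hq₁ ▸ hq)) y
    obtain ⟨z', hz'⟩ := hA m₂ (Nat.pos_of_mul_pos_left (hm₂ ▸ hm)) z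
    refine ⟨⟨![0, 0, z', y'], ?_⟩, ?_⟩
    · rw [AddMonoidHom.mem_ker, hP₃]
      have e1 : m • z' = 0 := by rw [hm₂, mul_smul, hz', hz]
      have e2 : (p * q) • y' = 0 := by rw [hq₁, ← mul_assoc, mul_smul, hy', hy]
      simp [e1, e2]
    · refine Prod.ext (Subtype.ext ?_) (Subtype.ext ?_)
      · exact hy'
      · change (p₂ * q) • (0 : A) + m₂ • z' = z
        rw [smul_zero, zero_add, hz']
  · rw [AddMonoidHom.prod_apply, Prod.mk_eq_zero, coordHom_eq_zero, coordHom_eq_zero]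
    obtain ⟨k, hk⟩ := k
    obtain ⟨hk0, hk1, hk2⟩ := hZ k hk
    change q₁ • k 3 = 0 ∧ (p₂ * q) • k 1 + m₂ • k 2 = 0 ↔ _
    constructor
    · rintro ⟨h3, h12⟩
      obtain ⟨l₃, hl₃, hl₃'⟩ := exists_common_quotient hA hg0 hp₁ hq₁ hc₁ (k 3) 0
        (by rw [h3, smul_zero])
      obtain ⟨l₂, hl₂, hl₂'⟩ := exists_common_quotient hA he0 hp₂ hm₂ hc₂ (k 2) (-(q • k 1))
        (by rw [smul_neg, ← mul_smul]; exact (neg_eq_of_add_eq_zero_right h12).symm)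
      refine ⟨![k 0, k 1, l₂, l₃], 0, ?_, ?_⟩
      · rw [hQ₃]
        simp [hk0, hl₂', hl₃']
      · rw [scale_four, map_zero, add_zero]
        funext i
        fin_cases i <;> simp [hl₂, hl₃]
    · rintro ⟨l, b, hl, h⟩
      have h : k = _ := h
      rw [scale_four, hP₂] at h
      rw [hQ₃] at hl
      have hl2 : q • l 1 + m • l 2 = 0 := congrFun hl 2
      have hl3 : q • l 3 = 0 := congrFun hl 4
      have e1 : k 1 = l 1 + -(m • b 1) := congrFun h 1
      have e2 : k 2 = p • l 2 + (p * q) • b 1 := congrFun h 2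
      have e3 : k 3 = p • l 3 + 0 := congrFun h 3
      rw [e1, e2, e3]
      constructor
      · rw [add_zero, ← mul_smul, hp₁, ← mul_assoc, mul_comm q₁, ← hq₁, mul_comm, mul_smul, hl3,
          smul_zero]
      · have e4 : p₂ • (q • l 1 + m • l 2) = 0 := by rw [hl2, smul_zero]
        rw [← e4, hp₂, hm₂]
        simp only [smul_add, smul_neg, ← mul_smul]
        rw [show m₂ * (e * p₂ * q) = p₂ * q * (e * m₂) by ring,
          show m₂ * (e * p₂) = p₂ * (e * m₂) by ring]
        abel

/-- Coordinates 0, 2 and 4 are removed by coboundaries, by divisibility. Trivial inflation forces `k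
1 = 0` and `p • k 3 = 0`; closedness gives `q • k 3 = m • k 3 = 0`. Thus `k 3` is the full
invariant. -/
theorem exists_anomaly_comm (hq : 0 < q) (hm : 0 < m)
    (hP₃ : ∀ k, P.δ A 3 k = ![m • k 0, 0, (p * q) • k 1 + m • k 2, 0, (p * q) • k 3])
    (hQ₃ : ∀ k, Q.δ A 3 k = ![m • k 0, 0, q • k 1 + m • k 2, 0, q • k 3])
    (hQ₄ : ∀ k, Q.δ A 4 k = ![0, -(m • k 1), q • k 1, -(m • k 3), q • k 3, 0]) :
    ∃ w : ((Q.δ A 4).ker ⊓ (P.δ A 3).range.comap (scale A (fun i => (p : ℤ) ^ (i / 2)) 5) :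
        AddSubgroup (Fin 5 → A)) →+ torsion A (Nat.gcd (Nat.gcd p q) m),
      Function.Surjective w ∧ ∀ k, w k = 0 ↔ ∃ b, k.1 = Q.δ A 3 b := by
  have hS : ∀ k ∈ ((Q.δ A 4).ker ⊓
      (P.δ A 3).range.comap (scale A (fun i => (p : ℤ) ^ (i / 2)) 5) : AddSubgroup (Fin 5 → A)),
      k 1 = 0 ∧ p • k 3 = 0 ∧ q • k 3 = 0 ∧ m • k 3 = 0 := fun k hk => by
    obtain ⟨hk, c, hc⟩ := hk
    have hk : Q.δ A 4 k = 0 := hk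
    rw [hQ₄] at hk
    rw [hP₃, scale_five] at hc
    exact ⟨(congrFun hc 1).symm, (congrFun hc 3).symm, congrFun hk 4,
      neg_eq_zero.1 (congrFun hk 3)⟩
  refine ⟨coordHom _ (Pi.evalAddMonoidHom _ 3) _ fun k hk => ?_, ?_, fun k => ?_⟩
  · obtain ⟨-, h1, h2, h3⟩ := hS k hk
    change _ • k 3 = 0
    rw [← addOrderOf_dvd_iff_nsmul_eq_zero] at *
    exact Nat.dvd_gcd (Nat.dvd_gcd h1 h2) h3
  · rintro ⟨y, hy⟩
    have hd : ∀ d, Nat.gcd (Nat.gcd p q) m ∣ d → d • y = 0 := fun d hd => by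
      rw [← addOrderOf_dvd_iff_nsmul_eq_zero]
      exact (addOrderOf_dvd_iff_nsmul_eq_zero.2 hy).trans hd
    have h1 := hd p ((Nat.gcd_dvd_left _ _).trans (Nat.gcd_dvd_left _ _))
    have h2 := hd q ((Nat.gcd_dvd_left _ _).trans (Nat.gcd_dvd_right _ _))
    have h3 := hd m (Nat.gcd_dvd_right _ _)
    refine ⟨⟨![0, 0, 0, y, 0], ?_, 0, ?_⟩, rfl⟩
    · change Q.δ A 4 _ = 0
      rw [hQ₄]
      simp [h2, h3]
    · rw [scale_five, map_zero]
      funext i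
      fin_cases i <;> simp [h1]
  · rw [coordHom_eq_zero]
    obtain ⟨k, hk⟩ := k
    change k 3 = 0 ↔ _
    constructor
    · intro h3
      obtain ⟨b₀, hb₀⟩ := hA m hm (k 0)
      obtain ⟨b₂, hb₂⟩ := hA m hm (k 2)
      obtain ⟨b₃, hb₃⟩ := hA q hq (k 4)
      refine ⟨![b₀, 0, b₂, b₃], ?_⟩
      rw [hQ₃]
      funext i
      fin_cases i <;> simp [hb₀, hb₂, hb₃, h3, (hS k hk).1]
    · rintro ⟨b, hb⟩
      rw [hQ₃] at hb
      exact congrFun hb 3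

/-- Only coordinate 3 survives: coordinate 2 is a coboundary since it may be halved, and `hpq` makes
the 2-torsion element `k 1` vanish under `q`, so that it is inflated. -/
theorem exists_weak_dihedral (hp : 0 < p) (hq : 0 < q) (hpq : Nat.gcd 2 (p * q) ∣ q)
    (hP₂ : ∀ k, P.δ A 2 k = ![0, 0, (p * q) • k 1 - 2 • k 2, 0])
    (hP₃ : ∀ k, P.δ A 3 k = ![2 • k 0, 2 • k 1, (p * q) • k 1, 0, (p * q) • k 3])
    (hQ₃ : ∀ k, Q.δ A 3 k = ![2 • k 0, 2 • k 1, q • k 1, 0, q • k 3]) :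
    ∃ w : (P.δ A 3).ker →+ torsion A (p * Nat.gcd p q),
      Function.Surjective w ∧ ∀ k, w k = 0 ↔ ∃ l b, Q.δ A 3 l = 0 ∧
        k.1 = scale A (fun i => (p : ℤ) ^ (i / 2)) 4 l + P.δ A 2 b := by
  obtain ⟨g, hg⟩ : ∃ g, g = Nat.gcd p q := ⟨_, rfl⟩
  have hg0 : 0 < g := hg ▸ Nat.gcd_pos_of_pos_left _ hp
  obtain ⟨p₁, q₁, hc₁, hp₁, hq₁⟩ := Nat.exists_coprime p q
  rw [← hg, mul_comm] at hp₁ hq₁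
  rw [← hg]
  have hZ : ∀ k ∈ (P.δ A 3).ker,
      2 • k 0 = 0 ∧ 2 • k 1 = 0 ∧ (p * q) • k 1 = 0 ∧ (p * q) • k 3 = 0 := fun k hk => by
    rw [AddMonoidHom.mem_ker, hP₃] at hk
    exact ⟨congrFun hk 0, congrFun hk 1, congrFun hk 2, congrFun hk 4⟩
  let f : (Fin 4 → A) →+ A := (nsmulAddMonoidHom q₁).comp (Pi.evalAddMonoidHom _ 3)
  have hf : ∀ k ∈ (P.δ A 3).ker, (p * g) • f k = 0 := fun k hk => by
    change (p * g) • q₁ • k 3 = 0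
    rw [← mul_smul, mul_assoc, ← hq₁, (hZ k hk).2.2.2]
  refine ⟨coordHom _ f _ hf, ?_, fun k => ?_⟩
  · rintro ⟨y, hy⟩
    have hy : (p * g) • y = 0 := hy
    obtain ⟨y', hy'⟩ := hA q₁ (Nat.pos_of_mul_pos_left (hq₁ ▸ hq)) y
    refine ⟨⟨![0, 0, 0, y'], ?_⟩, Subtype.ext hy'⟩
    rw [AddMonoidHom.mem_ker, hP₃]
    have e2 : (p * q) • y' = 0 := by rw [hq₁, ← mul_assoc, mul_smul, hy', hy]
    simp [e2]
  · rw [coordHom_eq_zero]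
    obtain ⟨k, hk⟩ := k
    obtain ⟨hk0, hk1, hk2, hk3⟩ := hZ k hk
    have hk4 : q • k 1 = 0 := by
      rw [← addOrderOf_dvd_iff_nsmul_eq_zero] at *
      exact (Nat.dvd_gcd hk1 hk2).trans hpq
    change q₁ • k 3 = 0 ↔ _
    constructor
    · intro h3
      obtain ⟨l₃, hl₃, hl₃'⟩ := exists_common_quotient hA hg0 hp₁ hq₁ hc₁ (k 3) 0
        (by rw [h3, smul_zero])
      obtain ⟨b₂, hb₂⟩ := hA 2 two_pos (-k 2)
      refine ⟨![k 0, k 1, 0, l₃], ![0, 0, b₂], ?_, ?_⟩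
      · rw [hQ₃]
        simp [hk0, hk1, hk4, hl₃']
      · rw [scale_four, hP₂]
        funext i
        fin_cases i <;> simp [hb₂, hl₃]
    · rintro ⟨l, b, hl, h⟩
      have h : k = _ := h
      rw [scale_four, hP₂] at h
      rw [hQ₃] at hl
      have hl3 : q • l 3 = 0 := congrFun hl 4
      have e3 : k 3 = p • l 3 + 0 := congrFun h 3
      rw [e3, add_zero, ← mul_smul, hp₁, ← mul_assoc, mul_comm q₁, ← hq₁, mul_comm, mul_smul, hl3,
        smul_zero]

/-- For `q = 1` the quotient has order two and every 4-cocycle bounds, so the inflation condition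
plays no role. -/
theorem exists_anomaly_dihedral_one (S : AddSubgroup (Fin 5 → A)) (hS : S ≤ (Q.δ A 4).ker)
    (hQ₃ : ∀ k, Q.δ A 3 k = ![2 • k 0, 2 • k 1, 1 • k 1, 0, 1 • k 3])
    (hQ₄ : ∀ k, Q.δ A 4 k = ![0, 0, 1 • k 1 - 2 • k 2, -(2 • k 3), 1 • k 3, 0]) :
    ∃ w : S →+ PUnit, Function.Surjective w ∧ ∀ k, w k = 0 ↔ ∃ b, k.1 = Q.δ A 3 b := by
  refine ⟨0, fun _ => ⟨0, rfl⟩, fun k => iff_of_true rfl ?_⟩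
  obtain ⟨k, hk⟩ := k
  have hk : Q.δ A 4 k = 0 := hS hk
  rw [hQ₄] at hk
  have h1 : 1 • k 1 - 2 • k 2 = 0 := congrFun hk 2
  have h3 : 1 • k 3 = 0 := congrFun hk 4
  rw [one_smul, sub_eq_zero] at h1
  rw [one_smul] at h3
  obtain ⟨b₀, hb₀⟩ := hA 2 two_pos (k 0)
  -- Closedness says `k 1 = 2 • k 2`, so the single entry `k 2` serves coordinates 1 and 2 together.
  refine ⟨![b₀, k 2, 0, k 4], ?_⟩
  rw [hQ₃]
  funext i
  fin_cases i <;> simp [hb₀, h1, h3]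

/-- Coboundaries change coordinates 1 and 2 by the same double, so the invariants are `k 1 - k 2`
and `k 3`, both 2-torsion. -/
theorem exists_anomaly_dihedral_two
    (hP₃ : ∀ k, P.δ A 3 k = ![2 • k 0, 2 • k 1, (2 * 2) • k 1, 0, (2 * 2) • k 3])
    (hQ₃ : ∀ k, Q.δ A 3 k = ![2 • k 0, 2 • k 1, 2 • k 1, 0, 2 • k 3])
    (hQ₄ : ∀ k, Q.δ A 4 k = ![0, 0, 2 • k 1 - 2 • k 2, -(2 • k 3), 2 • k 3, 0]) :
    ∃ w : ((Q.δ A 4).ker ⊓ (P.δ A 3).range.comap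
        (scale A (fun i => ((2 : ℕ) : ℤ) ^ (i / 2)) 5) : AddSubgroup (Fin 5 → A)) →+
        torsion A 2 × torsion A 2,
      Function.Surjective w ∧ ∀ k, w k = 0 ↔ ∃ b, k.1 = Q.δ A 3 b := by
  have hS : ∀ k ∈ ((Q.δ A 4).ker ⊓ (P.δ A 3).range.comap
      (scale A (fun i => ((2 : ℕ) : ℤ) ^ (i / 2)) 5) : AddSubgroup (Fin 5 → A)),
      2 • (k 1 - k 2) = 0 ∧ 2 • k 3 = 0 := fun k hk => by
    have hk : Q.δ A 4 k = 0 := hk.1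
    rw [hQ₄] at hk
    exact ⟨(smul_sub _ _ _).trans (congrFun hk 2), congrFun hk 4⟩
  refine ⟨(coordHom _ (Pi.evalAddMonoidHom (fun _ => A) 1 - Pi.evalAddMonoidHom (fun _ => A) 2) _
    fun k hk => (hS k hk).1).prod
    (coordHom _ (Pi.evalAddMonoidHom (fun _ => A) 3) _ fun k hk => (hS k hk).2), ?_, fun k => ?_⟩
  · rintro ⟨⟨y, hy⟩, ⟨z, hz⟩⟩
    have hy : 2 • y = 0 := hy
    have hz : 2 • z = 0 := hz
    -- A half of `y` trivializes the inflation: `2 • c = y` in coordinate 1, while coordinate 2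
    -- requires only `4 • c = 2 • y = 0`.
    obtain ⟨c, hc⟩ := hA 2 two_pos y
    refine ⟨⟨![0, y, 0, z, 0], ?_, ![0, c, 0, 0], ?_⟩, ?_⟩
    · change Q.δ A 4 _ = 0
      rw [hQ₄]
      simp [hy, hz]
    · rw [scale_five, hP₃]
      have : (2 * 2) • c = 0 := by rw [mul_smul, hc, hy]
      funext i
      fin_cases i <;> simp_all
    · exact Prod.ext (Subtype.ext (sub_zero y)) rfl
  · rw [AddMonoidHom.prod_apply, Prod.mk_eq_zero]
    refine (and_congr (coordHom_eq_zero _) (coordHom_eq_zero _)).trans ?_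
    obtain ⟨k, hk⟩ := k
    change k 1 - k 2 = 0 ∧ k 3 = 0 ↔ _
    constructor
    · rintro ⟨h1, h3⟩
      rw [sub_eq_zero] at h1
      obtain ⟨b₀, hb₀⟩ := hA 2 two_pos (k 0)
      obtain ⟨b₁, hb₁⟩ := hA 2 two_pos (k 1)
      obtain ⟨b₃, hb₃⟩ := hA 2 two_pos (k 4)
      refine ⟨![b₀, b₁, 0, b₃], ?_⟩
      rw [hQ₃]
      funext i
      fin_cases i <;> simp [hb₀, hb₁, hb₃, h3, ← h1]
    · rintro ⟨b, hb⟩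
      have hb : k = _ := hb
      rw [hQ₃] at hb
      rw [hb]
      simp

end Cochains

end BicyclicResolution

/-! ### The factors for commutative and dihedral extensions -/

namespace CyclicExtension

variable {G : Type} [Group G]

section Comm

variable {n m : ℕ} (E : CyclicExtension G n m) (h : Commute E.x E.y) {A : Type*} [AddCommGroup A]

theorem commTwist_δ_two (k : Fin 3 → A) :
    (E.commTwist h).resolution.δ A 2 k = ![0, -(m • k 1), n • k 1, 0] := by
  rw [BicyclicResolution.δ_two]
  simp [Twist.aug_ξ, Twist.aug_η, commTwist, aug_Y, Nat.even_iff]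

theorem commTwist_δ_three (k : Fin 4 → A) :
    (E.commTwist h).resolution.δ A 3 k =
      ![m • k 0, 0, n • k 1 + m • k 2, 0, n • k 3] := by
  rw [BicyclicResolution.δ_three]
  simp [Twist.aug_ξ, Twist.aug_η, commTwist, aug_Y, Nat.even_iff]

theorem commTwist_δ_four (k : Fin 5 → A) :
    (E.commTwist h).resolution.δ A 4 k =
      ![0, -(m • k 1), n • k 1, -(m • k 3), n • k 3, 0] := by
  rw [BicyclicResolution.δ_four]
  simp [Twist.aug_ξ, Twist.aug_η, commTwist, aug_Y, Nat.even_iff]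

/-- The two factors for `ℤ_m × ℤ_{pq}` with gapped symmetry `ℤ_p ⊂ ℤ_{pq}`. -/
theorem nonempty_equiv_comm {p q : ℕ} (E : CyclicExtension G (p * q) m) (h : Commute E.x E.y)
    (N : Subgroup G) [N.Normal] (hN : N = Subgroup.zpowers (E.x ^ q)) :
    Nonempty (WeakFactor G N ≃+ ZMod (p * Nat.gcd p q) × ZMod (Nat.gcd p m)) ∧
    Nonempty (AnomalyFactor G N ≃+ ZMod (Nat.gcd (Nat.gcd p q) m)) := by
  have hp : 0 < p := Nat.pos_of_mul_pos_right E.n_pos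
  have hq : 0 < q := Nat.pos_of_mul_pos_left E.n_pos
  have hg : 0 < Nat.gcd p q := Nat.gcd_pos_of_pos_left _ hp
  let E' := E.quotient p q rfl N hN
  have h' : Commute E'.x E'.y := h.map (QuotientGroup.mk' N)
  have F := E.quotient_hom p q rfl N hN (E.commTwist h) (E'.commTwist h')
    fun _ => ringMap_of _ _
  obtain ⟨e₁⟩ := nonempty_torsion_equiv (n := p * Nat.gcd p q) (by positivity)
  obtain ⟨e₂⟩ := nonempty_torsion_equiv (n := Nat.gcd p m) (Nat.gcd_pos_of_pos_left _ hp)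
  obtain ⟨e₃⟩ := nonempty_torsion_equiv (n := Nat.gcd (Nat.gcd p q) m)
    (Nat.gcd_pos_of_pos_left _ hg)
  constructor
  · obtain ⟨w, hw, hw'⟩ := BicyclicResolution.exists_weak_comm (A := Additive ℂˣ)
      (fun _ hn => exists_nsmul_eq hn) hp hq E.m_pos (E.commTwist_δ_two h)
      (E.commTwist_δ_three h) (E'.commTwist_δ_three h')
    obtain ⟨e⟩ := BicyclicResolution.nonempty_weakFactor_equiv F w hw hw'
    exact ⟨e.trans (e₁.prodCongr e₂)⟩
  · obtain ⟨w, hw, hw'⟩ := BicyclicResolution.exists_anomaly_comm (A := Additive ℂˣ)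
      (fun _ hn => exists_nsmul_eq hn) hq E.m_pos
      (E.commTwist_δ_three h) (E'.commTwist_δ_three h') (E'.commTwist_δ_four h')
    obtain ⟨e⟩ := BicyclicResolution.nonempty_anomalyFactor_equiv F w hw hw'
    exact ⟨e.trans e₃⟩

end Comm

section Dihedral

variable {n : ℕ} (E : CyclicExtension G n 2) (h : E.x * E.y * E.x = E.y)
  {A : Type*} [AddCommGroup A]

theorem dihedralTwist_δ_two (k : Fin 3 → A) :
    (E.dihedralTwist h).resolution.δ A 2 k = ![0, 0, n • k 1 - 2 • k 2, 0] := by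
  rw [BicyclicResolution.δ_two]
  simp [Twist.aug_ξ, Twist.aug_η, dihedralTwist, aug_X, aug_Y, Nat.even_iff, Finset.sum_range_succ,
    sub_eq_add_neg, ofNat_zsmul]

theorem dihedralTwist_δ_three (k : Fin 4 → A) :
    (E.dihedralTwist h).resolution.δ A 3 k =
      ![2 • k 0, 2 • k 1, n • k 1, 0, n • k 3] := by
  rw [BicyclicResolution.δ_three]
  simp [Twist.aug_ξ, Twist.aug_η, dihedralTwist, aug_X, aug_Y, Nat.even_iff, Finset.sum_range_succ,
    ofNat_zsmul]

theorem dihedralTwist_δ_four (k : Fin 5 → A) :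
    (E.dihedralTwist h).resolution.δ A 4 k =
      ![0, 0, n • k 1 - 2 • k 2, -(2 • k 3), n • k 3, 0] := by
  rw [BicyclicResolution.δ_four]
  simp [Twist.aug_ξ, Twist.aug_η, dihedralTwist, aug_X, aug_Y, Nat.even_iff, Finset.sum_range_succ,
    sub_eq_add_neg, ofNat_zsmul]

theorem exists_dihedral_hom {p q : ℕ} (E : CyclicExtension G (p * q) 2) (h : E.x * E.y * E.x = E.y)
    (N : Subgroup G) [N.Normal] (hN : N = Subgroup.zpowers (E.x ^ q)) :
    ∃ (E' : CyclicExtension (G ⧸ N) q 2) (h' : E'.x * E'.y * E'.x = E'.y),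
      BicyclicResolution.Hom (QuotientGroup.mk' N) (E.dihedralTwist h).resolution
        (E'.dihedralTwist h').resolution fun i => (p : ℤ) ^ (i / 2) := by
  let E' := E.quotient p q rfl N hN
  have h' : E'.x * E'.y * E'.x = E'.y := congrArg (QuotientGroup.mk' N) h
  have hX : ringMap (QuotientGroup.mk' N) E.X = E'.X := ringMap_of _ _
  have hY : ringMap (QuotientGroup.mk' N) E.Y = E'.Y := ringMap_of _ _
  refine ⟨E', h', E.quotient_hom p q rfl N hN (E.dihedralTwist h) (E'.dihedralTwist h') fun i => ?_⟩
  simp only [dihedralTwist]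
  split_ifs
  · exact hY
  · rw [map_neg, map_mul, hX, hY]
  · rw [map_neg, hY]
  · rw [map_mul, hX, hY]

theorem nonempty_weak_dihedral {p q : ℕ} (E : CyclicExtension G (p * q) 2)
    (h : E.x * E.y * E.x = E.y) (hpq : Nat.gcd 2 (p * q) ∣ q)
    (N : Subgroup G) [N.Normal] (hN : N = Subgroup.zpowers (E.x ^ q)) :
    Nonempty (WeakFactor G N ≃+ ZMod (p * Nat.gcd p q)) := by
  have hp : 0 < p := Nat.pos_of_mul_pos_right E.n_pos
  have hq : 0 < q := Nat.pos_of_mul_pos_left E.n_pos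
  have hg : 0 < Nat.gcd p q := Nat.gcd_pos_of_pos_left _ hp
  obtain ⟨E', h', F⟩ := E.exists_dihedral_hom h N hN
  obtain ⟨e₁⟩ := nonempty_torsion_equiv (n := p * Nat.gcd p q) (by positivity)
  obtain ⟨w, hw, hw'⟩ := BicyclicResolution.exists_weak_dihedral (A := Additive ℂˣ)
    (fun _ hn => exists_nsmul_eq hn) hp hq hpq (E.dihedralTwist_δ_two h)
    (E.dihedralTwist_δ_three h) (E'.dihedralTwist_δ_three h')
  obtain ⟨e⟩ := BicyclicResolution.nonempty_weakFactor_equiv F w hw hw'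
  exact ⟨e.trans e₁⟩

theorem nonempty_anomaly_dihedral_one {p : ℕ} (E : CyclicExtension G (p * 1) 2)
    (h : E.x * E.y * E.x = E.y) (N : Subgroup G) [N.Normal]
    (hN : N = Subgroup.zpowers (E.x ^ 1)) : Nonempty (AnomalyFactor G N ≃+ PUnit.{1}) := by
  obtain ⟨E', h', F⟩ := E.exists_dihedral_hom h N hN
  obtain ⟨w, hw, hw'⟩ := BicyclicResolution.exists_anomaly_dihedral_one (A := Additive ℂˣ)
    (fun _ hn => exists_nsmul_eq hn) _ inf_le_left
    (E'.dihedralTwist_δ_three h') (E'.dihedralTwist_δ_four h')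
  exact BicyclicResolution.nonempty_anomalyFactor_equiv F w hw hw'

theorem nonempty_anomaly_dihedral_two (E : CyclicExtension G (2 * 2) 2)
    (h : E.x * E.y * E.x = E.y) (N : Subgroup G) [N.Normal]
    (hN : N = Subgroup.zpowers (E.x ^ 2)) : Nonempty (AnomalyFactor G N ≃+ ZMod 2 × ZMod 2) := by
  obtain ⟨E', h', F⟩ := E.exists_dihedral_hom h N hN
  obtain ⟨e₁⟩ := nonempty_torsion_equiv two_pos
  obtain ⟨w, hw, hw'⟩ := BicyclicResolution.exists_anomaly_dihedral_two (A := Additive ℂˣ)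
    (fun _ hn => exists_nsmul_eq hn) (E.dihedralTwist_δ_three h)
    (E'.dihedralTwist_δ_three h') (E'.dihedralTwist_δ_four h')
  obtain ⟨e⟩ := BicyclicResolution.nonempty_anomalyFactor_equiv F w hw hw'
  exact ⟨e.trans (e₁.prodCongr e₁)⟩

end Dihedral

end CyclicExtension

theorem hasClassification_and_not_hasIGSPT {G : Type} [Group G] {N : Subgroup G} [N.Normal]
    {W E : Type} [AddCommGroup W] [AddCommGroup E] [Subsingleton E]
    (hW : Nonempty (WeakFactor G N ≃+ W)) (hE : Nonempty (AnomalyFactor G N ≃+ E)) :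
    HasClassification G N W PUnit ∧ ¬ HasIGSPT G N := by
  obtain ⟨w⟩ := hW
  obtain ⟨e⟩ := hE
  have := uniqueOfSubsingleton (0 : E)
  refine ⟨hasClassification_of_equiv G N w (e.trans
    (AddEquiv.ofUnique : E ≃+ PUnit)), ?_⟩
  rw [hasIGSPT_iff_of_equiv G N e]
  exact not_nontrivial E

/-! ### The groups of the examples as split extensions -/

namespace CyclicExtension

/-- `ℤ_m × ℤ_n`, as an extension of `ℤ_m` by `ℤ_n`. -/
def prod (n m : ℕ) (hn : 0 < n) (hm : 0 < m) :
    CyclicExtension (Multiplicative (ZMod m × ZMod n)) n m where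
  x := Multiplicative.ofAdd (0, 1)
  y := Multiplicative.ofAdd (1, 0)
  β := AddMonoidHom.toMultiplicative (AddMonoidHom.fst (ZMod m) (ZMod n))
  n_pos := hn
  m_pos := hm
  orderOf_x := by
    rw [orderOf_ofAdd_eq_addOrderOf]
    exact (addOrderOf_injective (AddMonoidHom.inr (ZMod m) (ZMod n))
      (fun _ _ h => congrArg Prod.snd h) 1).trans (ZMod.addOrderOf_one n)
  y_pow := by
    rw [← ofAdd_nsmul]
    simp
  β_x := rfl
  β_y := rfl
  mem_zpowers g hg := by
    have : NeZero n := ⟨hn.ne'⟩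
    refine ⟨(g.toAdd.2.val : ℤ), ?_⟩
    change Multiplicative.ofAdd ((0 : ZMod m), (1 : ZMod n)) ^ (g.toAdd.2.val : ℤ) = g
    rw [zpow_natCast, ← ofAdd_nsmul]
    refine congrArg Multiplicative.ofAdd (Prod.ext ?_ ?_)
    · have h : g.toAdd.1 = 0 := hg
      exact (smul_zero (ZMod.val g.toAdd.2)).trans h.symm
    · simp
      rfl

theorem cyclic_zpowers (n q : ℕ) (hn : 0 < n) :
    Subgroup.zpowers (Multiplicative.ofAdd (q : ZMod n)) =
      Subgroup.zpowers ((cyclic n hn).x ^ q) := by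
  congr 1
  change _ = Multiplicative.ofAdd (1 : ZMod n) ^ q
  rw [← ofAdd_nsmul, nsmul_one]

theorem prod_zpowers (n m q : ℕ) (hn : 0 < n) (hm : 0 < m) :
    Subgroup.zpowers (Multiplicative.ofAdd ((0 : ZMod m), (q : ZMod n))) =
      Subgroup.zpowers ((prod n m hn hm).x ^ q) := by
  congr 1
  change _ = Multiplicative.ofAdd ((0 : ZMod m), (1 : ZMod n)) ^ q
  rw [← ofAdd_nsmul]
  simp

/-- The symmetric group on three letters. -/
def perm : CyclicExtension (Equiv.Perm (Fin 3)) (3 * 1) 2 where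
  x := finRotate 3
  y := Equiv.swap 0 1
  β := (MonoidHom.mk' (fun u : ℤˣ => Multiplicative.ofAdd (if u = 1 then (0 : ZMod 2) else 1))
    (by decide)).comp Equiv.Perm.sign
  n_pos := by norm_num
  m_pos := by norm_num
  orderOf_x := by
    change orderOf (finRotate 3) = 3
    exact orderOf_eq_prime (by decide) (by decide)
  y_pow := by decide
  β_x := by decide
  β_y := by decide
  mem_zpowers := by
    have h : ∀ g : Equiv.Perm (Fin 3), Equiv.Perm.sign g = 1 →
        ∃ k : Fin 3, finRotate 3 ^ (k : ℕ) = g := by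
      decide
    intro g hg
    obtain ⟨k, hk⟩ := h g (by
      revert hg
      change Multiplicative.ofAdd (if Equiv.Perm.sign g = 1 then (0 : ZMod 2) else 1) = 1 → _
      split_ifs with h
      · exact fun _ => h
      · intro h'; exact absurd h' (by decide))
    exact ⟨(k : ℕ), by simpa using hk⟩

theorem perm_zpowers : alternatingGroup (Fin 3) = Subgroup.zpowers (perm.x ^ 1) := by
  ext g
  rw [Equiv.Perm.mem_alternatingGroup]
  constructor
  · intro h
    rw [pow_one]
    exact perm.mem_zpowers g (by
      change Multiplicative.ofAdd (if Equiv.Perm.sign g = 1 then (0 : ZMod 2) else 1) = 1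
      rw [if_pos h]
      rfl)
  · rintro ⟨k, rfl⟩
    have h : Equiv.Perm.sign (perm.x) = 1 := by decide
    simp [h]

/-- The dihedral group of order eight. -/
def dihedral : CyclicExtension (DihedralGroup 4) (2 * 2) 2 where
  x := .r 1
  y := .sr 0
  β := MonoidHom.mk' (fun g => Multiplicative.ofAdd (match g with
    | .r _ => (0 : ZMod 2)
    | .sr _ => 1)) (by decide)
  n_pos := by norm_num
  m_pos := by norm_num
  orderOf_x := DihedralGroup.orderOf_r_one
  y_pow := by decide
  β_x := by decide
  β_y := by decide
  mem_zpowers g hg := by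
    cases g with
    | r i => exact ⟨(i.val : ℤ), by simp⟩
    | sr i =>
      have h : Multiplicative.ofAdd (1 : ZMod 2) ≠ 1 := by decide
      exact absurd hg h

theorem dihedral_zpowers :
    Subgroup.center (DihedralGroup 4) = Subgroup.zpowers (dihedral.x ^ 2) := by
  ext g
  rw [Subgroup.mem_center_iff]
  constructor
  · intro h
    have h' : ∀ g : DihedralGroup 4, (∀ k, k * g = g * k) →
        ∃ k : Fin 2, (DihedralGroup.r 1 ^ 2) ^ (k : ℕ) = g := by
      decide
    obtain ⟨k, hk⟩ := h' g h
    exact ⟨(k : ℕ), (zpow_natCast _ _).trans hk⟩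
  · rintro ⟨k, rfl⟩ g
    have h : Commute g (dihedral.x ^ 2) := by
      revert g
      change ∀ g : DihedralGroup 4, g * DihedralGroup.r 1 ^ 2 = DihedralGroup.r 1 ^ 2 * g
      decide
    exact h.zpow_right k

end CyclicExtension

open CyclicExtension

/-- The modulus `n` is kept apart from `p * q` so that the literal `4` fits with `rfl`. -/
theorem classification_cyclic {n p q : ℕ} (hn : n = p * q) (hp : 0 < p) (hq : 0 < q) :
    HasClassification (Multiplicative (ZMod n))
        (Subgroup.zpowers (Multiplicative.ofAdd (q : ZMod n)))
        (ZMod (p * Nat.gcd p q)) PUnit ∧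
      ¬ HasIGSPT (Multiplicative (ZMod n))
        (Subgroup.zpowers (Multiplicative.ofAdd (q : ZMod n))) := by
  subst hn
  obtain ⟨⟨w⟩, ⟨e⟩⟩ := (cyclic (p * q) (Nat.mul_pos hp hq)).nonempty_equiv_comm
    (Commute.all _ _) _ (cyclic_zpowers _ q _)
  -- Here `m = 1`, so the second weak factor and the anomaly factor become `ZMod 1`.
  rw [Nat.gcd_one_right] at w e
  exact hasClassification_and_not_hasIGSPT ⟨w.trans AddEquiv.prodUnique⟩ ⟨e⟩

theorem classification_prod {n m p q : ℕ} (hn : n = p * q) (hm : 0 < m) (hp : 0 < p) (hq : 0 < q) :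
    HasClassification (Multiplicative (ZMod m × ZMod n))
        (Subgroup.zpowers (Multiplicative.ofAdd ((0 : ZMod m), (q : ZMod n))))
        (ZMod (p * Nat.gcd p q) × ZMod (Nat.gcd p m)) (ZMod (Nat.gcd (Nat.gcd p q) m)) ∧
      (HasIGSPT (Multiplicative (ZMod m × ZMod n))
        (Subgroup.zpowers (Multiplicative.ofAdd ((0 : ZMod m), (q : ZMod n)))) ↔
        Nat.gcd (Nat.gcd p q) m ≠ 1) := by
  subst hn
  obtain ⟨⟨w⟩, ⟨e⟩⟩ := (prod (p * q) m (Nat.mul_pos hp hq) hm).nonempty_equiv_comm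
    (Commute.all _ _) _ (prod_zpowers _ m q _ _)
  refine ⟨hasClassification_of_equiv _ _ w e, ?_⟩
  rw [hasIGSPT_iff_of_equiv _ _ e, ← not_subsingleton_iff_nontrivial, ZMod.subsingleton_iff]

end GaplessSPT

end

/-! ### Assembly of the general statement and the six cases -/

theorem mainTheorem6 :
    -- the general formula, and the criterion for intrinsically gapless SPTs
    (∀ (G : Type) [Group G] [Finite G] (N : Subgroup G) [N.Normal],
      GaplessSPT.HasClassification G N
        (GaplessSPT.WeakFactor G N) (GaplessSPT.AnomalyFactor G N) ∧
      (GaplessSPT.HasIGSPT G N ↔ (GaplessSPT.infl G N 4).ker ≠ ⊥)) ∧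
    -- `ℤ_4 ⊃ ℤ_2 = ⟨2⟩`
    (GaplessSPT.HasClassification (Multiplicative (ZMod 4))
        (Subgroup.zpowers (Multiplicative.ofAdd (2 : ZMod 4))) (ZMod 4) PUnit ∧
      ¬ GaplessSPT.HasIGSPT (Multiplicative (ZMod 4))
        (Subgroup.zpowers (Multiplicative.ofAdd (2 : ZMod 4)))) ∧
    -- `ℤ_{pq} ⊃ ℤ_p = ⟨q⟩`
    (∀ p q : ℕ, 0 < p → 0 < q →
      GaplessSPT.HasClassification (Multiplicative (ZMod (p * q)))
        (Subgroup.zpowers (Multiplicative.ofAdd (q : ZMod (p * q))))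
        (ZMod (p * Nat.gcd p q)) PUnit ∧
      ¬ GaplessSPT.HasIGSPT (Multiplicative (ZMod (p * q)))
        (Subgroup.zpowers (Multiplicative.ofAdd (q : ZMod (p * q))))) ∧
    -- `ℤ_2 × ℤ_4 ⊃ ℤ_2 = ⟨(0, 2)⟩`
    (GaplessSPT.HasClassification (Multiplicative (ZMod 2 × ZMod 4))
        (Subgroup.zpowers (Multiplicative.ofAdd ((0 : ZMod 2), (2 : ZMod 4))))
        (ZMod 2 × ZMod 4) (ZMod 2) ∧
      GaplessSPT.HasIGSPT (Multiplicative (ZMod 2 × ZMod 4))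
        (Subgroup.zpowers (Multiplicative.ofAdd ((0 : ZMod 2), (2 : ZMod 4))))) ∧
    -- `ℤ_{n₁} × ℤ_{pq} ⊃ ℤ_p = ⟨(0, q)⟩`
    (∀ n₁ p q : ℕ, 0 < n₁ → 0 < p → 0 < q →
      GaplessSPT.HasClassification (Multiplicative (ZMod n₁ × ZMod (p * q)))
        (Subgroup.zpowers (Multiplicative.ofAdd ((0 : ZMod n₁), (q : ZMod (p * q)))))
        (ZMod (p * Nat.gcd p q) × ZMod (Nat.gcd p n₁)) (ZMod (Nat.gcd (Nat.gcd p q) n₁)) ∧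
      (GaplessSPT.HasIGSPT (Multiplicative (ZMod n₁ × ZMod (p * q)))
        (Subgroup.zpowers (Multiplicative.ofAdd ((0 : ZMod n₁), (q : ZMod (p * q))))) ↔
        Nat.gcd (Nat.gcd p q) n₁ ≠ 1)) ∧
    -- `S_3 ⊃ ℤ_3 = A_3`
    (GaplessSPT.HasClassification (Equiv.Perm (Fin 3)) (alternatingGroup (Fin 3))
        (ZMod 3) PUnit ∧
      ¬ GaplessSPT.HasIGSPT (Equiv.Perm (Fin 3)) (alternatingGroup (Fin 3))) ∧
    -- `D_4 ⊃ Z(D_4)`, the dihedral group of order `8`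
    (GaplessSPT.HasClassification (DihedralGroup 4) (Subgroup.center (DihedralGroup 4))
        (ZMod 4) (ZMod 2 × ZMod 2) ∧
      GaplessSPT.HasIGSPT (DihedralGroup 4) (Subgroup.center (DihedralGroup 4))) := by
  refine ⟨fun G _ _ N _ => ⟨GaplessSPT.hasClassification_of_equiv G N (AddEquiv.refl _)
    (AddEquiv.refl _), GaplessSPT.hasIGSPT_iff G N⟩, ?_, ?_, ?_, ?_, ?_, ?_⟩
  · exact GaplessSPT.classification_cyclic (n := 4) (p := 2) (q := 2) rfl two_pos two_pos
  · exact fun p q hp hq => GaplessSPT.classification_cyclic rfl hp hq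
  · obtain ⟨⟨w, e, h⟩, h'⟩ := GaplessSPT.classification_prod (n := 4) (m := 2) (p := 2) (q := 2)
      rfl two_pos two_pos two_pos
    -- With `p = q = m = 2` the general formula produces the weak factor as `ℤ₄ × ℤ₂`, in the
    -- opposite order.
    exact ⟨GaplessSPT.hasClassification_of_equiv _ _ (w.trans AddEquiv.prodComm) e,
      h'.2 (by norm_num)⟩
  · exact fun n p q hn hp hq => GaplessSPT.classification_prod rfl hn hp hq
  · have h : GaplessSPT.CyclicExtension.perm.x * GaplessSPT.CyclicExtension.perm.y *
        GaplessSPT.CyclicExtension.perm.x = GaplessSPT.CyclicExtension.perm.y := by decide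
    exact GaplessSPT.hasClassification_and_not_hasIGSPT
      (GaplessSPT.CyclicExtension.perm.nonempty_weak_dihedral h (by norm_num) _
        GaplessSPT.CyclicExtension.perm_zpowers)
      (GaplessSPT.CyclicExtension.perm.nonempty_anomaly_dihedral_one h _
        GaplessSPT.CyclicExtension.perm_zpowers)
  · have h : GaplessSPT.CyclicExtension.dihedral.x * GaplessSPT.CyclicExtension.dihedral.y *
        GaplessSPT.CyclicExtension.dihedral.x = GaplessSPT.CyclicExtension.dihedral.y := by decide
    obtain ⟨w⟩ := GaplessSPT.CyclicExtension.dihedral.nonempty_weak_dihedral h (by norm_num) _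
      GaplessSPT.CyclicExtension.dihedral_zpowers
    obtain ⟨e⟩ := GaplessSPT.CyclicExtension.dihedral.nonempty_anomaly_dihedral_two h _
      GaplessSPT.CyclicExtension.dihedral_zpowers
    exact ⟨GaplessSPT.hasClassification_of_equiv _ _ w e,
      (GaplessSPT.hasIGSPT_iff_of_equiv _ _ e).2 inferInstance⟩
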